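/- **Setting.** Let $N,T\in\mathbb N$ with $T\ge 2$ and $NT\ge 3^{11}$; $\log$ is the natural logarithm. Let $G$ be an undirected graph on the arms $[N]$, let $K=\theta(G)$ be its clique covering number (the least number of nonempty cliques into which $[N]$ can be partitioned), and let $V_1,\dots,V_K$ be a partition of $[N]$ into $K$ cliques. Write $V(i)$ for the clique containing $i$ and $p(A)=\sum_{i\in A}p_i$. *Losses.* The stochastic losses $\tilde\ell_1,\dots,\tilde\ell_T\in[0,1]^N$ are i.i.d. with mean $\mu\in[0,1]^N$, and $i^\star=\arg\min_i\mu_i$ is unique. The adversary turns them into losses $\ell_1,\dots,\ell_T\in[0,1]^N$. It may be adaptive and randomized: $\ell_t$ may depend on the stochastic losses and on the arms and losses of earlier rounds, but not on the arm $I_t$; and for every $t$ the vector $\tilde\ell_t$ is independent of the interaction $(I_s,\ell_s)_{s<t}$ of the earlier rounds. Put $C=\mathbb E\big[\sum_{t=1}^T\|\ell_t-\tilde\ell_t\|_\infty\big]$ and $$\Delta_k=\min_{i\in V_k,\,i\ne i^\star}(\mu_i-\mu_{i^\star}),\qquad\text{with }\Delta_k=0\text{ if }V_k=\{i^\star\}.$$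 *Algorithm.* Let $\alpha=2(\log^2(NT)+1)$, $\beta=9$, $\gamma=1/(NT)$, $\eta_t=1/\sqrt t$, $$\Psi(p)=-\alpha\sum_{k=1}^K\sqrt{p(V_k)}+\sum_{k=1}^K\frac1{\sqrt{p(V_k)}}\sum_{i\in V_k}p_i\log\frac{p_i}{p(V_k)},\qquad \Phi(p)=-\beta\sum_{k=1}^K\log p(V_k).$$ In round $t=1,\dots,T$ the algorithm computes $$p_t=\arg\min\Big\{\sum_{s<t}\hat\ell_s\cdot p+\eta_t^{-1}\Psi(p)+\Phi(p)\;:\;p\in\mathbb R^N,\ \sum_ip_i=1,\ p_i\ge\gamma\ \forall i\Big\},$$ draws the arm $I_t$ from $p_t$ (given $(I_s,\ell_s)_{s<t}$ and $\ell_t$, the arm is $i$ with conditional probability $p_{t,i}$), observes $\ell_{t,i}$ for $i=I_t$ and for all neighbours $i$ of $I_t$ in $G$, and sets $\hat\ell_{t,i}=\dfrac{\ell_{t,i}}{p_t(V(i))}\mathbb 1\{i\in V(I_t)\}$ for all $i$. **Theorem.** The pseudo-regret $\mathcal R_T=\mathbb E\big[\sum_{t=1}^T\ell_{t,I_t}\big]-\min_{i\in[N]}\mathbb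 E\big[\sum_{t=1}^T\ell_{t,i}\big]$ of this algorithm satisfies $$\mathcal R_T\le 184\log^2(NT)\cdot\min\Big\{\sqrt{KT},\ \log^2(NT)\sum_{k:\Delta_k>0}\frac{\log T}{\Delta_k}+\sqrt{C\sum_{k:\Delta_k>0}\frac{\log T}{\Delta_k}}\Big\}.$$ In particular, $\mathcal R_T\le184\log^2(NT)\sqrt{KT}$ whatever the corruption is, and $\mathcal R_T\le184\log^4(NT)\sum_{k:\Delta_k>0}\frac{\log T}{\Delta_k}$ if $C=0$. -/

import Mathlib

open MeasureTheory ProbabilityTheory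

noncomputable section

/-! ### Clique partitions of the feedback graph -/

/-- `c : Fin N → Fin K` encodes a partition of the arms into `K` nonempty cliques
`V_k = {i | c i = k}` of `G`; the part containing the arm `i` is `V(i) = V_{c i}`. -/
def IsCliquePartition {N K : ℕ} (G : SimpleGraph (Fin N)) (c : Fin N → Fin K) : Prop :=
  Function.Surjective c ∧ ∀ k : Fin K, G.IsClique {i | c i = k}

/-- The clique covering number `θ(G)`. -/
def cliqueCoveringNumber {N : ℕ} (G : SimpleGraph (Fin N)) : ℕ :=
  sInf {k : ℕ | ∃ c : Fin N → Fin k, IsCliquePartition G c}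

/-- A clique partition of minimum cardinality. -/
def IsMinimumCliquePartition {N K : ℕ} (G : SimpleGraph (Fin N)) (c : Fin N → Fin K) : Prop :=
  IsCliquePartition G c ∧ K = cliqueCoveringNumber G

/-- `p(V_k) = ∑_{i ∈ V_k} p_i`. -/
def cliqueMass {N K : ℕ} (c : Fin N → Fin K) (p : Fin N → ℝ) (k : Fin K) : ℝ :=
  ∑ i with c i = k, p i

/-! ### The regularizers -/

/-- The Tsallis-Shannon entropy
`Ψ_α(p) = -α ∑_k √(p(V_k)) + ∑_k (1 / √(p(V_k))) ∑_{i ∈ V_k} p_i log (p_i / p(V_k))`. -/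
def tsallisShannon {N K : ℕ} (α : ℝ) (c : Fin N → Fin K) (p : Fin N → ℝ) : ℝ :=
  -α * ∑ k, √(cliqueMass c p k) +
    ∑ k, (1 / √(cliqueMass c p k)) *
      ∑ i with c i = k, p i * Real.log (p i / cliqueMass c p k)

/-- The log-barrier of the clique marginals, `Φ(p) = -β ∑_k log p(V_k)`. -/
def cliqueLogBarrier {N K : ℕ} (β : ℝ) (c : Fin N → Fin K) (p : Fin N → ℝ) : ℝ :=
  -β * ∑ k, Real.log (cliqueMass c p k)

/-- The truncated simplex `{p ∈ S_N : p_i ≥ γ for all i}`. -/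
def truncatedSimplex (N : ℕ) (γ : ℝ) : Set (Fin N → ℝ) :=
  {p | p ∈ stdSimplex ℝ (Fin N) ∧ ∀ i, γ ≤ p i}

/-! ### The algorithm

Rounds are indexed by `t : Fin T`, so that `t` stands for the round number `t + 1`. -/

/-- The step size: `1 / √(round number)`. -/
def stepSize {T : ℕ} (t : Fin T) : ℝ := 1 / √((t : ℝ) + 1)

/-- The regularizer of round `t`, `R_t = η_t⁻¹ Ψ_α + Φ` with `α = 2 (log² (N T) + 1)`, `β = 9`. -/
def regularizer {N K T : ℕ} (c : Fin N → Fin K) (t : Fin T) (p : Fin N → ℝ) : ℝ :=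
  (stepSize t)⁻¹ * tsallisShannon (2 * (Real.log ((N : ℝ) * T) ^ 2 + 1)) c p +
    cliqueLogBarrier 9 c p

open Classical in
/-- The feedback after playing `j` against the loss vector `l`: the losses of `j` and of the
neighbours of `j` in `G` are revealed, the others are not. -/
def graphFeedback {N : ℕ} (G : SimpleGraph (Fin N)) (j : Fin N) (l : Fin N → ℝ) :
    Fin N → Option ℝ :=
  fun i => if i = j ∨ G.Adj j i then some (l i) else none

/-- The loss estimator `l_i / p(V(i)) · 𝟙{i ∈ V(j)}`, computed from the feedback `fb` after
playing the arm `j`.  Members of the clique `V(j)` are always observed, so that the default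
value is never used. -/
def lossEstimate {N K : ℕ} (c : Fin N → Fin K) (p : Fin N → ℝ) (j : Fin N)
    (fb : Fin N → Option ℝ) (i : Fin N) : ℝ :=
  if c i = c j then (fb i).getD 0 / cliqueMass c p (c i) else 0

/-- The cumulative loss estimate over the rounds before `t`. -/
def cumulativeEstimate {N K T : ℕ} (G : SimpleGraph (Fin N)) (c : Fin N → Fin K)
    (l : Fin T → Fin N → ℝ) (I : Fin T → Fin N) (p : Fin T → Fin N → ℝ) (t : Fin T)
    (i : Fin N) : ℝ :=
  ∑ s ∈ Finset.Iio t, lossEstimate c (p s) (I s) (graphFeedback G (I s) (l s)) i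

/-- `p` is the sequence of predictions of the FTRL algorithm when the losses are `l` and the
chosen arms are `I`: in every round `t`, `p t` minimizes
`q ↦ (cumulative estimate before t) · q + R_t(q)` over the simplex truncated at `1 / (N T)`. -/
def IsFTRLPrediction {N K T : ℕ} (G : SimpleGraph (Fin N)) (c : Fin N → Fin K)
    (l : Fin T → Fin N → ℝ) (I : Fin T → Fin N) (p : Fin T → Fin N → ℝ) : Prop :=
  ∀ t : Fin T,
    p t ∈ truncatedSimplex N (1 / ((N : ℝ) * T)) ∧
    IsMinOn (fun q => ∑ i, cumulativeEstimate G c l I p t i * q i + regularizer c t q)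
      (truncatedSimplex N (1 / ((N : ℝ) * T))) (p t)

/-! ### The corrupted stochastic environment -/

/-- The σ-algebra of the interaction before round `t`: arms and (corrupted) losses of all
earlier rounds. -/
abbrev pastInteraction {Ω : Type*} {N T : ℕ} (l : Fin T → Ω → Fin N → ℝ) (I : Fin T → Ω → Fin N)
    (t : Fin T) : MeasurableSpace Ω :=
  ⨆ s : Fin T, ⨆ _ : s < t,
    MeasurableSpace.comap (I s) inferInstance ⊔ MeasurableSpace.comap (l s) inferInstance

/-- The adversarially corrupted stochastic setting: `lt` are the stochastic losses, i.i.d. with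
law `ν`, and `l` the losses after corruption.  The adversary may choose `l t` using the earlier
interaction, the stochastic losses and further randomness; it does not know the arm `I t`, and
the stochastic loss of a round is independent of the interaction in the earlier rounds. -/
structure IsCorruptedStochastic {Ω : Type*} [MeasurableSpace Ω] {N T : ℕ} (P : Measure Ω)
    (ν : Measure (Fin N → ℝ)) (lt l : Fin T → Ω → Fin N → ℝ) (I : Fin T → Ω → Fin N) :
    Prop where
  measurable_stoch : ∀ t, Measurable (lt t)
  measurable_loss : ∀ t, Measurable (l t)
  measurable_arm : ∀ t, Measurable (I t)
  stoch_mem : ∀ t ω i, lt t ω i ∈ Set.Icc (0 : ℝ) 1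
  loss_mem : ∀ t ω i, l t ω i ∈ Set.Icc (0 : ℝ) 1
  law : ∀ t, P.map (lt t) = ν
  iindep : iIndepFun lt P
  indep_past : ∀ t, Indep (MeasurableSpace.comap (lt t) inferInstance) (pastInteraction l I t) P

/-- In every round `t` the arm `I t` is drawn from `p t`: given the earlier interaction and the
loss vector of the round, the arm is `i` with conditional probability `p t i`. -/
def IsSampledFrom {Ω : Type*} [MeasurableSpace Ω] {N T : ℕ} (P : Measure Ω)
    (l : Fin T → Ω → Fin N → ℝ) (I : Fin T → Ω → Fin N) (p : Fin T → Ω → Fin N → ℝ) : Prop :=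
  ∀ (t : Fin T) (i : Fin N),
    P[Set.indicator {ω | I t ω = i} (fun _ => (1 : ℝ)) |
        pastInteraction l I t ⊔ MeasurableSpace.comap (l t) inferInstance]
      =ᵐ[P] fun ω => p t ω i

/-- The corruption level `C = E[∑_t ‖ℓ_t - ℓ̃_t‖_∞]` (the norm of `Fin N → ℝ` is the sup norm). -/
def corruptionLevel {Ω : Type*} [MeasurableSpace Ω] {N T : ℕ} (P : Measure Ω)
    (lt l : Fin T → Ω → Fin N → ℝ) : ℝ :=
  ∫ ω, ∑ t, ‖l t ω - lt t ω‖ ∂P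

/-- The pseudo-regret `E[∑_t ℓ_{t,I_t}] - min_i E[∑_t ℓ_{t,i}]`. -/
def pseudoRegret {Ω : Type*} [MeasurableSpace Ω] {N T : ℕ} (P : Measure Ω)
    (l : Fin T → Ω → Fin N → ℝ) (I : Fin T → Ω → Fin N) : ℝ :=
  (∫ ω, ∑ t, l t ω (I t ω) ∂P) - ⨅ i : Fin N, ∫ ω, ∑ t, l t ω i ∂P

/-- The mean loss `μ_i` of arm `i` under the law `ν`. -/
def meanLoss {N : ℕ} (ν : Measure (Fin N → ℝ)) (i : Fin N) : ℝ := ∫ x, x i ∂ν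

/-- `Δ_k = min_{i ∈ V_k, i ≠ i⋆} (μ_i - μ_{i⋆})`; it is `0` if `V_k = {i⋆}`, since the infimum
of the empty set of reals is `0` here. -/
def cliqueGap {N K : ℕ} (ν : Measure (Fin N → ℝ)) (c : Fin N → Fin K) (istar : Fin N)
    (k : Fin K) : ℝ :=
  sInf ((fun i => meanLoss ν i - meanLoss ν istar) '' {i | c i = k ∧ i ≠ istar})

/-- `∑_{k : Δ_k > 0} log T / Δ_k`. -/
def gapSum {N K : ℕ} (T : ℕ) (ν : Measure (Fin N → ℝ)) (c : Fin N → Fin K) (istar : Fin N) : ℝ :=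
  ∑ k with 0 < cliqueGap ν c istar k, Real.log T / cliqueGap ν c istar k

end

/-!
The predictions follow the regularized leader with the regularizer `√t Ψ + Φ`, where `Ψ` is the
Tsallis-Shannon entropy.  Write `P = a²`, `Q = b²` for the masses of a clique under `p`, `q`, let
`r`, `s` be the conditional distributions on the clique, `H` the Shannon entropy and `KL` the
relative entropy.  The contribution of the clique to `Ψ` is `-a (α + H(r))`, and its Bregman
divergence has the closed form (`potentialDivergence_eq`)

`(1 / a) (b² KL(s, r) + (b - a)² (α + H(r)) / 2 + b (b - a) (H(s) - H(r)))`.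

On the truncated simplex `|log r_i| ≤ L := log (N T)`, and `|H(s) - H(r)| ≤ KL + L √KL` by an
inequality of Pinsker type (`abs_entropyOn_sub_le`).  As `α = 2 (L² + 1)` and `L ≥ 12`, the cross
term is absorbed and `(1 / a) (b² KL / 2 + 20 (b - a)²)` remains (`le_potentialDivergence`).  This
is the only curvature that is used: of the log-barrier only the convexity is needed, and for its
value at the comparator it costs `9 K L`.

Stability: by Fenchel's inequality for `KL`, a round in which the clique of mass `P` is played costs
at most `7 / √(t P)`.  If the clique of the best arm `istar` is played and has mass at least `3 / 4`,
the loss estimates are first shifted by the estimate of `istar`; the cost is then proportional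
to the conditional probability of missing `istar` in its clique.  Averaged over the arm, both cases
give `(35 / √t) ∑_k √q_k`, where `q_k` is the mass of the clique without `istar`
(`sum_mul_stabilityBound_le`).  Penalty: `-Ψ(p) - α ≤ (α + L) ∑_k √q_k`
(`neg_tsallisShannon_sub_le`), and `-α` is, up to `α / T`, an upper bound for `Ψ` at the comparator
of every arm.  The regret against every arm `j`, not only `istar`, is therefore at most
`3 L² E[∑_t ∑_k √(q_{t,k} / t)]` plus lower-order terms (`regret_le_sum_residualMass`).

The Cauchy-Schwarz inequality gives the bound `√(K T)`.  For the bound in terms of the gaps, the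
regret is at least `E[∑_t ∑_k Δ_k q_{t,k}] - 2 C` (`sum_cliqueGap_mul_le_regret`), since the
prediction is a function of the past and hence independent of the stochastic loss of the round; for
this, the minimizer is shown to depend continuously on the cumulative losses
(`exists_continuous_minimizer`).  Combining the two bounds with weights `1 + x` and `-x` optimizes
out the masses (`self_bounding`), and `x` is chosen according to the corruption.
-/

/-! ### Entropy and relative entropy on a finite set -/

section Entropy

variable {ι : Type*} {V : Finset ι} {r s : ι → ℝ} {L : ℝ}

/-- The Shannon entropy `-∑_{i ∈ V} r_i log r_i`. -/
noncomputable def entropyOn (V : Finset ι) (r : ι → ℝ) : ℝ := -∑ i ∈ V, r i * Real.log (r i)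

/-- The relative entropy `∑_{i ∈ V} s_i log (s_i / r_i)`, with the logarithm of the quotient
written as a difference. -/
noncomputable def relEntropyOn (V : Finset ι) (s r : ι → ℝ) : ℝ :=
  ∑ i ∈ V, s i * (Real.log (s i) - Real.log (r i))

/-- A probability vector on `V` with positive entries. -/
structure IsPosProb (V : Finset ι) (r : ι → ℝ) : Prop where
  pos : ∀ i ∈ V, 0 < r i
  sum_eq : ∑ i ∈ V, r i = 1

lemma IsPosProb.le_one (hr : IsPosProb V r) {i : ι} (hi : i ∈ V) : r i ≤ 1 :=
  hr.sum_eq ▸ Finset.single_le_sum (fun j hj => (hr.pos j hj).le) hi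

lemma IsPosProb.log_nonpos (hr : IsPosProb V r) {i : ι} (hi : i ∈ V) : Real.log (r i) ≤ 0 :=
  Real.log_nonpos (hr.pos i hi).le (hr.le_one hi)

lemma entropyOn_nonneg (hr : IsPosProb V r) : 0 ≤ entropyOn V r := by
  rw [entropyOn, ← Finset.sum_neg_distrib]
  refine Finset.sum_nonneg fun i hi => ?_
  have := mul_nonneg (hr.pos i hi).le (neg_nonneg.2 (hr.log_nonpos hi))
  linarith

lemma entropyOn_le (hr : IsPosProb V r) (hL : ∀ i ∈ V, -L ≤ Real.log (r i)) :
    entropyOn V r ≤ L := by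
  have h : ∑ i ∈ V, r i * -L ≤ ∑ i ∈ V, r i * Real.log (r i) :=
    Finset.sum_le_sum fun i hi => mul_le_mul_of_nonneg_left (hL i hi) (hr.pos i hi).le
  rw [← Finset.sum_mul, hr.sum_eq] at h
  rw [entropyOn]
  linarith

/-- The relative entropy dominates the squared Hellinger distance. -/
lemma sum_sq_sqrt_sub_le_relEntropyOn (hr : IsPosProb V r) (hs : IsPosProb V s) :
    ∑ i ∈ V, (√(r i) - √(s i)) ^ 2 ≤ relEntropyOn V s r := by
  have key : ∀ i ∈ V, (√(r i) - √(s i)) ^ 2 ≤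
      s i * (Real.log (s i) - Real.log (r i)) + r i - s i := by
    intro i hi
    have hr0 := hr.pos i hi
    have hs0 := hs.pos i hi
    have h := Real.log_le_sub_one_of_pos (div_pos (Real.sqrt_pos.2 hr0) (Real.sqrt_pos.2 hs0))
    rw [Real.log_div (Real.sqrt_pos.2 hr0).ne' (Real.sqrt_pos.2 hs0).ne',
      Real.log_sqrt hr0.le, Real.log_sqrt hs0.le] at h
    have h2 := mul_le_mul_of_nonneg_left h hs0.le
    have h3 : s i * (√(r i) / √(s i) - 1) = √(s i) * √(r i) - s i := by
      have h0 := (Real.sqrt_pos.2 hs0).ne'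
      nth_rewrite 1 [← Real.mul_self_sqrt hs0.le]
      nth_rewrite 5 [← Real.mul_self_sqrt hs0.le]
      field_simp
    nlinarith [Real.sq_sqrt hr0.le, Real.sq_sqrt hs0.le]
  refine (Finset.sum_le_sum key).trans_eq ?_
  rw [Finset.sum_sub_distrib, Finset.sum_add_distrib, hr.sum_eq, hs.sum_eq, relEntropyOn]
  ring

lemma relEntropyOn_nonneg (hr : IsPosProb V r) (hs : IsPosProb V s) : 0 ≤ relEntropyOn V s r :=
  (Finset.sum_nonneg fun _ _ => sq_nonneg _).trans (sum_sq_sqrt_sub_le_relEntropyOn hr hs)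

lemma eq_of_relEntropyOn_eq_zero (hr : IsPosProb V r) (hs : IsPosProb V s)
    (h : relEntropyOn V s r = 0) : ∀ i ∈ V, s i = r i := by
  have h0 := sum_sq_sqrt_sub_le_relEntropyOn hr hs
  rw [h] at h0
  have h1 := (Finset.sum_eq_zero_iff_of_nonneg fun i _ => sq_nonneg (√(r i) - √(s i))).1
    (le_antisymm h0 (Finset.sum_nonneg fun _ _ => sq_nonneg _))
  intro i hi
  have h2 : √(r i) = √(s i) := by have := pow_eq_zero_iff (two_ne_zero) |>.1 (h1 i hi); linarith
  rw [← Real.sq_sqrt (hr.pos i hi).le, ← Real.sq_sqrt (hs.pos i hi).le, h2]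

/-- Pinsker's inequality with the constant that the Hellinger distance gives. -/
lemma sq_sum_abs_sub_le (hr : IsPosProb V r) (hs : IsPosProb V s) :
    (∑ i ∈ V, |r i - s i|) ^ 2 ≤ 4 * relEntropyOn V s r := by
  have h1 : ∑ i ∈ V, |r i - s i| = ∑ i ∈ V, |√(r i) - √(s i)| * (√(r i) + √(s i)) := by
    refine Finset.sum_congr rfl fun i hi => ?_
    rw [← abs_of_nonneg (add_nonneg (Real.sqrt_nonneg (r i)) (Real.sqrt_nonneg (s i))), ← abs_mul]
    congr 1
    nlinarith [Real.sq_sqrt (hr.pos i hi).le, Real.sq_sqrt (hs.pos i hi).le]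
  have h2 : ∑ i ∈ V, (√(r i) + √(s i)) ^ 2 ≤ 4 := by
    have : ∀ i ∈ V, (√(r i) + √(s i)) ^ 2 ≤ 2 * r i + 2 * s i := fun i hi => by
      nlinarith [Real.sq_sqrt (hr.pos i hi).le, Real.sq_sqrt (hs.pos i hi).le,
        sq_nonneg (√(r i) - √(s i))]
    refine (Finset.sum_le_sum this).trans_eq ?_
    rw [Finset.sum_add_distrib, ← Finset.mul_sum, ← Finset.mul_sum, hr.sum_eq, hs.sum_eq]
    norm_num
  have h3 := Finset.sum_mul_sq_le_sq_mul_sq V (fun i => |√(r i) - √(s i)|)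
    (fun i => √(r i) + √(s i))
  simp only [sq_abs] at h3
  rw [h1]
  refine h3.trans ?_
  have h4 := sum_sq_sqrt_sub_le_relEntropyOn hr hs
  have h5 : 0 ≤ ∑ i ∈ V, (√(r i) - √(s i)) ^ 2 := Finset.sum_nonneg fun _ _ => sq_nonneg _
  nlinarith

lemma relEntropyOn_le (hs : IsPosProb V s)
    (hL : ∀ i ∈ V, -L ≤ Real.log (r i)) : relEntropyOn V s r ≤ L := by
  have h : relEntropyOn V s r ≤ ∑ i ∈ V, s i * L := by
    refine Finset.sum_le_sum fun i hi => mul_le_mul_of_nonneg_left ?_ (hs.pos i hi).le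
    linarith [hL i hi, hs.log_nonpos hi]
  rwa [← Finset.sum_mul, hs.sum_eq, one_mul] at h

/-- Continuity of the entropy with respect to the relative entropy.  Since both vectors sum to
one, `log r_i ∈ [-L, 0]` may be centred at `-L / 2`. -/
lemma abs_entropyOn_sub_le (hr : IsPosProb V r) (hs : IsPosProb V s)
    (hL : ∀ i ∈ V, -L ≤ Real.log (r i)) (hL0 : 0 ≤ L) :
    |entropyOn V s - entropyOn V r| ≤ relEntropyOn V s r + L * √(relEntropyOn V s r) := by
  set D := relEntropyOn V s r with hD
  have hD0 : 0 ≤ D := relEntropyOn_nonneg hr hs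
  have h1 : entropyOn V s - entropyOn V r =
      -D + ∑ i ∈ V, (r i - s i) * (Real.log (r i) + L / 2) := by
    have : ∑ i ∈ V, (r i - s i) * (Real.log (r i) + L / 2) =
        ∑ i ∈ V, (r i * Real.log (r i) - s i * Real.log (s i) +
          s i * (Real.log (s i) - Real.log (r i)) + r i * (L / 2) - s i * (L / 2)) :=
      Finset.sum_congr rfl fun i _ => by ring
    rw [this, Finset.sum_sub_distrib, Finset.sum_add_distrib, Finset.sum_add_distrib,
      Finset.sum_sub_distrib, ← Finset.sum_mul, ← Finset.sum_mul, hr.sum_eq, hs.sum_eq, entropyOn,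
      entropyOn, hD, relEntropyOn]
    ring
  have h2 : |∑ i ∈ V, (r i - s i) * (Real.log (r i) + L / 2)| ≤
      (∑ i ∈ V, |r i - s i|) * (L / 2) := by
    rw [Finset.sum_mul]
    refine (Finset.abs_sum_le_sum_abs _ _).trans (Finset.sum_le_sum fun i hi => ?_)
    rw [abs_mul]
    refine mul_le_mul_of_nonneg_left (abs_le.2 ⟨?_, ?_⟩) (abs_nonneg _)
    · linarith [hL i hi]
    · linarith [hr.log_nonpos hi]
  have h3 : ∑ i ∈ V, |r i - s i| ≤ 2 * √D := by
    refine abs_le_of_sq_le_sq' ?_ (by positivity) |>.2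
    rw [mul_pow, Real.sq_sqrt hD0]
    linarith [sq_sum_abs_sub_le hr hs]
  rw [h1]
  calc |-D + ∑ i ∈ V, (r i - s i) * (Real.log (r i) + L / 2)|
      ≤ |-D| + |∑ i ∈ V, (r i - s i) * (Real.log (r i) + L / 2)| := abs_add_le _ _
    _ ≤ D + L * √D := by
      rw [abs_neg, abs_of_nonneg hD0]
      nlinarith [mul_le_mul_of_nonneg_right h3 (by positivity : 0 ≤ L / 2)]

/-- Fenchel's inequality between the relative entropy and the exponential. -/
lemma sum_mul_le_relEntropyOn (hr : IsPosProb V r) (hs : IsPosProb V s) (x : ι → ℝ) :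
    ∑ i ∈ V, x i * s i ≤ relEntropyOn V s r - 1 + ∑ i ∈ V, r i * Real.exp (x i) := by
  have key : ∀ i ∈ V, x i * s i ≤
      s i * (Real.log (s i) - Real.log (r i)) - s i + r i * Real.exp (x i) := by
    intro i hi
    have hr0 := hr.pos i hi
    have hs0 := hs.pos i hi
    have h := Real.log_le_sub_one_of_pos (div_pos (mul_pos hr0 (Real.exp_pos (x i))) hs0)
    rw [Real.log_div (by positivity) hs0.ne', Real.log_mul hr0.ne' (Real.exp_pos _).ne',
      Real.log_exp] at h
    have h2 := mul_le_mul_of_nonneg_left h hs0.le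
    have h3 : s i * (r i * Real.exp (x i) / s i - 1) = r i * Real.exp (x i) - s i := by
      field_simp
    linarith
  refine (Finset.sum_le_sum key).trans_eq ?_
  rw [Finset.sum_add_distrib, Finset.sum_sub_distrib, hs.sum_eq, relEntropyOn]

/-- The entropy of `r` is small when `r` is concentrated on one element. -/
lemma entropyOn_le_of_mem (hr : IsPosProb V r) (hL : ∀ i ∈ V, -L ≤ Real.log (r i)) {j : ι}
    (hj : j ∈ V) : entropyOn V r ≤ (L + 1) * (1 - r j) := by
  classical
  have hsum := hr.sum_eq
  rw [← Finset.add_sum_erase V r hj] at hsum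
  rw [entropyOn, ← Finset.add_sum_erase V _ hj]
  have h1 : ∑ i ∈ V.erase j, r i * -L ≤ ∑ i ∈ V.erase j, r i * Real.log (r i) :=
    Finset.sum_le_sum fun i hi => mul_le_mul_of_nonneg_left (hL i (Finset.mem_of_mem_erase hi))
      (hr.pos i (Finset.mem_of_mem_erase hi)).le
  rw [← Finset.sum_mul] at h1
  have h2 : r j - 1 ≤ r j * Real.log (r j) := by
    have h := mul_le_mul_of_nonneg_left (Real.one_sub_inv_le_log_of_pos (hr.pos j hj))
      (hr.pos j hj).le
    rwa [mul_sub, mul_inv_cancel₀ (hr.pos j hj).ne', mul_one] at h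
  have h3 : ∑ i ∈ V.erase j, r i = 1 - r j := by linarith
  rw [h3] at h1
  linarith

end Entropy

/-- A quadratic upper bound for the exponential on a neighbourhood of `0` of moderate size. -/
lemma exp_le_one_add_add_two_mul_sq {x : ℝ} (hx : |x| ≤ 2.4) :
    Real.exp x ≤ 1 + x + 2 * x ^ 2 := by
  -- apply `exp u ≤ 1 + u + u²` to `u = x / 4` and take fourth powers
  set u := x / 4 with hu
  have hu1 : |u| ≤ 0.6 := by rw [hu, abs_div, abs_of_pos (by norm_num : (0 : ℝ) < 4)]; linarith
  obtain ⟨hl, hr⟩ := abs_le.1 hu1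
  have h1 : Real.exp u ≤ 1 + u + u ^ 2 := by
    have := Real.abs_exp_sub_one_sub_id_le (hu1.trans (by norm_num))
    linarith [(abs_le.1 this).2]
  have h2 : Real.exp x = Real.exp u ^ 4 := by
    rw [← Real.exp_nat_mul]
    congr 1
    rw [hu]
    push_cast
    ring
  have h3 : Real.exp u ^ 4 ≤ (1 + u + u ^ 2) ^ 4 := pow_le_pow_left₀ (Real.exp_pos _).le h1 4
  have hx4 : x = 4 * u := by rw [hu]; ring
  rw [h2, hx4]
  refine h3.trans ?_
  have h4 : 4 + 6 * (1 + u) ^ 2 + 4 * u * (1 + u) ^ 3 + u ^ 2 * (1 + u) ^ 4 ≤ 32 := by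
    have h5 : 0 ≤ 1 + u := by linarith
    have h6 : 1 + u ≤ 1.6 := by linarith
    have e2 : (1 + u) ^ 2 ≤ 1.6 ^ 2 := pow_le_pow_left₀ h5 h6 2
    have e3 : (1 + u) ^ 3 ≤ 1.6 ^ 3 := pow_le_pow_left₀ h5 h6 3
    have e4 : (1 + u) ^ 4 ≤ 1.6 ^ 4 := pow_le_pow_left₀ h5 h6 4
    have e5 : u ^ 2 ≤ 0.36 := by nlinarith
    have e6 : u * (1 + u) ^ 3 ≤ 0.6 * 1.6 ^ 3 :=
      (mul_le_mul_of_nonneg_right hr (by positivity)).trans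
        (mul_le_mul_of_nonneg_left e3 (by norm_num))
    have e7 : u ^ 2 * (1 + u) ^ 4 ≤ 0.36 * 1.6 ^ 4 :=
      (mul_le_mul_of_nonneg_right e5 (by positivity)).trans
        (mul_le_mul_of_nonneg_left e4 (by norm_num))
    norm_num at e2 e6 e7
    linarith
  nlinarith [mul_le_mul_of_nonneg_left h4 (sq_nonneg u)]

/-! ### The potential of a single clique and its Bregman divergence -/

section Potential

variable {ι : Type*} {V : Finset ι} {p q : ι → ℝ} {L α : ℝ}

/-- The contribution of the clique `V` to the Tsallis-Shannon entropy. -/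
noncomputable def cliquePotential (α : ℝ) (V : Finset ι) (p : ι → ℝ) : ℝ :=
  -α * √(∑ i ∈ V, p i) +
    (1 / √(∑ i ∈ V, p i)) * ∑ i ∈ V, p i * Real.log (p i / ∑ j ∈ V, p j)

/-- The conditional distribution of `p` on `V`. -/
noncomputable def condProb (V : Finset ι) (p : ι → ℝ) (i : ι) : ℝ := p i / ∑ j ∈ V, p j

/-- The derivative of `cliquePotential α V` at `p` in the direction `q - p`. -/
noncomputable def potentialDeriv (α : ℝ) (V : Finset ι) (p q : ι → ℝ) : ℝ :=
  (∑ i ∈ V, q i - ∑ i ∈ V, p i) / (2 * √(∑ i ∈ V, p i)) * (-α + entropyOn V (condProb V p)) +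
    (1 / √(∑ i ∈ V, p i)) * ∑ i ∈ V, (q i - p i) * Real.log (condProb V p i)

/-- The Bregman divergence of `cliquePotential α V`. -/
noncomputable def potentialDivergence (α : ℝ) (V : Finset ι) (q p : ι → ℝ) : ℝ :=
  cliquePotential α V q - cliquePotential α V p - potentialDeriv α V p q

lemma isPosProb_condProb (hV : V.Nonempty) (hp : ∀ i ∈ V, 0 < p i) :
    IsPosProb V (condProb V p) where
  pos i hi := div_pos (hp i hi) (Finset.sum_pos hp hV)
  sum_eq := by
    unfold condProb
    rw [← Finset.sum_div, div_self (Finset.sum_pos hp hV).ne']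

lemma sum_mul_condProb (hV : V.Nonempty) (hp : ∀ i ∈ V, 0 < p i) (i : ι) :
    (∑ j ∈ V, p j) * condProb V p i = p i :=
  mul_div_cancel₀ _ (Finset.sum_pos hp hV).ne'

lemma cliquePotential_eq (hV : V.Nonempty) (hp : ∀ i ∈ V, 0 < p i) :
    cliquePotential α V p = -√(∑ i ∈ V, p i) * (α + entropyOn V (condProb V p)) := by
  have hP := Finset.sum_pos hp hV
  have h1 : ∑ i ∈ V, p i * Real.log (p i / ∑ j ∈ V, p j) =
      (√(∑ i ∈ V, p i)) ^ 2 * -entropyOn V (condProb V p) := by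
    rw [Real.sq_sqrt hP.le, entropyOn, neg_neg, Finset.mul_sum]
    refine Finset.sum_congr rfl fun i _ => ?_
    rw [← mul_assoc, sum_mul_condProb hV hp, condProb]
  have h2 := (Real.sqrt_pos.2 hP).ne'
  rw [cliquePotential, h1]
  field_simp
  ring

/-- The Bregman divergence in closed form, in terms of the square roots of the masses and of the
entropies of the conditional distributions. -/
lemma potentialDivergence_eq (hV : V.Nonempty) (hp : ∀ i ∈ V, 0 < p i) (hq : ∀ i ∈ V, 0 < q i) :
    potentialDivergence α V q p =
      (1 / √(∑ i ∈ V, p i)) *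
        ((√(∑ i ∈ V, q i)) ^ 2 * relEntropyOn V (condProb V q) (condProb V p) +
          (√(∑ i ∈ V, q i) - √(∑ i ∈ V, p i)) ^ 2 / 2 * (α + entropyOn V (condProb V p)) +
          √(∑ i ∈ V, q i) * (√(∑ i ∈ V, q i) - √(∑ i ∈ V, p i)) *
            (entropyOn V (condProb V q) - entropyOn V (condProb V p))) := by
  have hP := Finset.sum_pos hp hV
  have hQ := Finset.sum_pos hq hV
  have h1 : ∑ i ∈ V, (q i - p i) * Real.log (condProb V p i) =
      (√(∑ i ∈ V, q i)) ^ 2 *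
        (-relEntropyOn V (condProb V q) (condProb V p) - entropyOn V (condProb V q)) +
      (√(∑ i ∈ V, p i)) ^ 2 * entropyOn V (condProb V p) := by
    rw [Real.sq_sqrt hP.le, Real.sq_sqrt hQ.le, relEntropyOn, entropyOn, entropyOn,
      ← Finset.sum_neg_distrib, sub_neg_eq_add, ← Finset.sum_add_distrib, mul_neg, Finset.mul_sum,
      Finset.mul_sum, ← sub_eq_add_neg, ← Finset.sum_sub_distrib]
    refine Finset.sum_congr rfl fun i _ => ?_
    linear_combination (-Real.log (condProb V p i)) * sum_mul_condProb hV hq i +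
      Real.log (condProb V p i) * sum_mul_condProb hV hp i
  rw [potentialDivergence, cliquePotential_eq hV hp, cliquePotential_eq hV hq, potentialDeriv, h1]
  have ha := (Real.sqrt_pos.2 hP).ne'
  have hPa := (Real.sq_sqrt hP.le).symm
  have hQb := (Real.sq_sqrt hQ.le).symm
  generalize √(∑ i ∈ V, p i) = a at *
  generalize √(∑ i ∈ V, q i) = b at *
  rw [hPa, hQb]
  field_simp
  ring

/-- The coefficient `α ≥ 2 (L² + 1)` of the Tsallis part absorbs the indefinite cross term of the
Bregman divergence, and a quadratic term with a large constant is left over. -/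
lemma le_potentialDivergence (hV : V.Nonempty) (hp : ∀ i ∈ V, 0 < p i) (hq : ∀ i ∈ V, 0 < q i)
    (hL : ∀ i ∈ V, -L ≤ Real.log (condProb V p i)) (hL12 : 12 ≤ L) (hα : 2 * (L ^ 2 + 1) ≤ α) :
    (1 / √(∑ i ∈ V, p i)) *
        ((√(∑ i ∈ V, q i)) ^ 2 / 2 * relEntropyOn V (condProb V q) (condProb V p) +
          20 * (√(∑ i ∈ V, q i) - √(∑ i ∈ V, p i)) ^ 2) ≤ potentialDivergence α V q p := by
  have hr := isPosProb_condProb hV hp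
  have hs := isPosProb_condProb hV hq
  rw [potentialDivergence_eq hV hp hq]
  refine mul_le_mul_of_nonneg_left ?_ (by positivity)
  have hD0 := relEntropyOn_nonneg hr hs
  have hDL := relEntropyOn_le hs hL
  have hH0 := entropyOn_nonneg hr
  have habs := abs_entropyOn_sub_le hr hs hL (by linarith)
  generalize relEntropyOn V (condProb V q) (condProb V p) = D at *
  generalize entropyOn V (condProb V q) - entropyOn V (condProb V p) = h at *
  generalize entropyOn V (condProb V p) = H at *
  generalize √(∑ i ∈ V, p i) = a at *
  generalize √(∑ i ∈ V, q i) = b at *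
  have hh : h ^ 2 ≤ 2 * (L ^ 2 - 19) * D := by
    have h1 : h ^ 2 ≤ (D + L * √D) ^ 2 := sq_le_sq' (by linarith [(abs_le.1 habs).1])
      ((le_abs_self h).trans habs)
    have h2 : (√D) ^ 2 = D := Real.sq_sqrt hD0
    have h3 : (D + L * √D) ^ 2 ≤ 5 * D ^ 2 + 1.25 * (L ^ 2 * D) := by
      have : (D + L * √D) ^ 2 = D ^ 2 + 2 * D * (L * √D) + L ^ 2 * D := by
        linear_combination L ^ 2 * h2
      have h4 := sq_nonneg (2 * D - 1 / 2 * (L * √D))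
      have : (2 * D - 1 / 2 * (L * √D)) ^ 2 = 4 * D ^ 2 - 2 * D * (L * √D) + 0.25 * (L ^ 2 * D) := by
        linear_combination L ^ 2 / 4 * h2
      nlinarith
    have h5 : D ^ 2 ≤ L * D := by nlinarith
    have h6 : 5 * L + 1.25 * L ^ 2 ≤ 2 * (L ^ 2 - 19) := by nlinarith
    nlinarith [mul_le_mul_of_nonneg_right h6 hD0]
  -- the quadratic form `b² D / 2 + (L² - 19) (b - a)² + b (b - a) h` is nonnegative
  have hM : 0 < L ^ 2 - 19 := by nlinarith
  have key : 0 ≤ b ^ 2 / 2 * D + (L ^ 2 - 19) * (b - a) ^ 2 + b * (b - a) * h := by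
    have h1 : 0 ≤ (L ^ 2 - 19) * (b ^ 2 / 2 * D + (L ^ 2 - 19) * (b - a) ^ 2 + b * (b - a) * h) := by
      nlinarith [sq_nonneg ((L ^ 2 - 19) * (b - a) + b * h / 2),
        mul_le_mul_of_nonneg_left hh (sq_nonneg b)]
    exact nonneg_of_mul_nonneg_right h1 hM
  have h8 := mul_le_mul_of_nonneg_left (add_le_add hα hH0) (sq_nonneg (b - a))
  nlinarith

lemma potentialDivergence_nonneg (hV : V.Nonempty) (hp : ∀ i ∈ V, 0 < p i)
    (hq : ∀ i ∈ V, 0 < q i) (hL : ∀ i ∈ V, -L ≤ Real.log (condProb V p i)) (hL12 : 12 ≤ L)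
    (hα : 2 * (L ^ 2 + 1) ≤ α) : 0 ≤ potentialDivergence α V q p := by
  have hD0 := relEntropyOn_nonneg (isPosProb_condProb hV hp) (isPosProb_condProb hV hq)
  exact le_trans (by positivity) (le_potentialDivergence hV hp hq hL hL12 hα)

lemma eq_of_potentialDivergence_nonpos (hV : V.Nonempty) (hp : ∀ i ∈ V, 0 < p i)
    (hq : ∀ i ∈ V, 0 < q i) (hL : ∀ i ∈ V, -L ≤ Real.log (condProb V p i)) (hL12 : 12 ≤ L)
    (hα : 2 * (L ^ 2 + 1) ≤ α) (h : potentialDivergence α V q p ≤ 0) : ∀ i ∈ V, q i = p i := by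
  have hr := isPosProb_condProb hV hp
  have hs := isPosProb_condProb hV hq
  have hP := Finset.sum_pos hp hV
  have hQ := Finset.sum_pos hq hV
  have hD0 := relEntropyOn_nonneg hr hs
  have h1 := (le_potentialDivergence hV hp hq hL hL12 hα).trans h
  have h2 := nonpos_of_mul_nonpos_right h1 (one_div_pos.2 (Real.sqrt_pos.2 hP))
  rw [Real.sq_sqrt hQ.le] at h2
  have h3 : 0 ≤ (∑ i ∈ V, q i) / 2 * relEntropyOn V (condProb V q) (condProb V p) := by positivity
  have h4 : (√(∑ i ∈ V, q i) - √(∑ i ∈ V, p i)) ^ 2 = 0 := by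
    nlinarith [sq_nonneg (√(∑ i ∈ V, q i) - √(∑ i ∈ V, p i))]
  have h5 : ∑ i ∈ V, q i = ∑ i ∈ V, p i := by
    rw [← Real.sq_sqrt hP.le, ← Real.sq_sqrt hQ.le,
      sub_eq_zero.1 (pow_eq_zero_iff two_ne_zero |>.1 h4)]
  have h6 : relEntropyOn V (condProb V q) (condProb V p) = 0 := by
    refine le_antisymm ?_ hD0
    rw [h4] at h2
    by_contra hcon
    have := mul_pos (half_pos hQ) (not_le.1 hcon)
    linarith
  intro i hi
  rw [← sum_mul_condProb hV hq, ← sum_mul_condProb hV hp, h5,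
    eq_of_relEntropyOn_eq_zero hr hs h6 i hi]

lemma hasDerivAt_cliquePotential (hV : V.Nonempty) (hp : ∀ i ∈ V, 0 < p i) :
    HasDerivAt (fun x : ℝ => cliquePotential α V (fun i => p i + x * (q i - p i)))
      (potentialDeriv α V p q) 0 := by
  have hP := Finset.sum_pos hp hV
  have hlin : ∀ i, HasDerivAt (fun x : ℝ => p i + x * (q i - p i)) (q i - p i) 0 := fun i => by
    simpa using ((hasDerivAt_id (0 : ℝ)).mul_const (q i - p i)).const_add (p i)
  have hmass : HasDerivAt (fun x : ℝ => ∑ i ∈ V, (p i + x * (q i - p i)))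
      (∑ i ∈ V, q i - ∑ i ∈ V, p i) 0 := by
    rw [← Finset.sum_sub_distrib]
    exact HasDerivAt.fun_sum fun i _ => hlin i
  have hmass0 : ∑ i ∈ V, (p i + 0 * (q i - p i)) = ∑ i ∈ V, p i := by simp
  have hsqrt := hmass.sqrt (by rw [hmass0]; exact hP.ne')
  have hent : HasDerivAt (fun x : ℝ => ∑ i ∈ V, (p i + x * (q i - p i)) *
      Real.log ((p i + x * (q i - p i)) / ∑ j ∈ V, (p j + x * (q j - p j))))
      (∑ i ∈ V, (q i - p i) * Real.log (condProb V p i)) 0 := by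
    have h1 : HasDerivAt (fun x : ℝ => ∑ i ∈ V, (p i + x * (q i - p i)) *
      Real.log ((p i + x * (q i - p i)) / ∑ j ∈ V, (p j + x * (q j - p j)))) _ 0 :=
      HasDerivAt.fun_sum fun i hi => (hlin i).mul
        (((hlin i).div hmass (by rw [hmass0]; exact hP.ne')).log
          (by simpa [hmass0] using ⟨(hp i hi).ne', hP.ne'⟩))
    refine h1.congr_deriv ?_
    simp only [Pi.div_apply, zero_mul, add_zero]
    -- the terms coming from the logarithm cancel because the conditional masses sum to one
    have h2 : ∀ i ∈ V, (q i - p i) * Real.log (p i / ∑ j ∈ V, p j) +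
        p i * ((((q i - p i) * (∑ j ∈ V, p j) - p i * (∑ j ∈ V, q j - ∑ j ∈ V, p j)) /
          (∑ j ∈ V, p j) ^ 2) / (p i / ∑ j ∈ V, p j)) =
        (q i - p i) * Real.log (condProb V p i) +
          (q i - p i - p i * ((∑ j ∈ V, q j - ∑ j ∈ V, p j) / ∑ j ∈ V, p j)) := by
      intro i hi
      have := (hp i hi).ne'
      have := hP.ne'
      rw [condProb]
      field_simp
    refine (Finset.sum_congr rfl h2).trans ?_
    rw [Finset.sum_add_distrib, Finset.sum_sub_distrib, Finset.sum_sub_distrib, ← Finset.sum_mul,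
      mul_div_cancel₀ _ hP.ne', sub_self, add_zero]
  have h := (hsqrt.const_mul (-α)).add (((hasDerivAt_const (0 : ℝ) (1 : ℝ)).div hsqrt
    (by rw [hmass0]; exact (Real.sqrt_pos.2 hP).ne')).mul hent)
  refine h.congr_deriv ?_
  have hE : ∑ i ∈ V, p i * Real.log (p i / ∑ j ∈ V, p j) =
      (√(∑ i ∈ V, p i)) ^ 2 * -entropyOn V (condProb V p) := by
    rw [Real.sq_sqrt hP.le, entropyOn, neg_neg, Finset.mul_sum]
    refine Finset.sum_congr rfl fun i _ => ?_
    rw [← mul_assoc, sum_mul_condProb hV hp, condProb]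
  simp only [Pi.div_apply, zero_mul, add_zero, hE, potentialDeriv]
  have ha := (Real.sqrt_pos.2 hP).ne'
  generalize √(∑ i ∈ V, p i) = a at *
  field_simp
  ring

end Potential

/-! ### Stability of a single clique -/

section Stability

variable {ι : Type*} {V : Finset ι} {p q d : ι → ℝ} {L α w ρ : ℝ}

/-- The relative entropy controls a linear functional to second order. -/
lemma sum_mul_sub_le_relEntropyOn {r s : ι → ℝ} (hr : IsPosProb V r) (hs : IsPosProb V s)
    (hd : ∀ i ∈ V, |d i| ≤ 1) (hρ : ∑ i ∈ V, r i * |d i| ≤ ρ) {c : ℝ} (hc : 1 / 2.4 ≤ c) :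
    ∑ i ∈ V, d i * (r i - s i) ≤ c * relEntropyOn V s r + 2 * ρ / c := by
  have hc0 : 0 < c := lt_of_lt_of_le (by norm_num) hc
  have hF := sum_mul_le_relEntropyOn hr hs (fun i => -d i / c)
  have hexp : ∀ i ∈ V, r i * Real.exp (-d i / c) ≤
      r i - r i * d i / c + 2 / c ^ 2 * (r i * |d i|) := by
    intro i hi
    have h1 : |(-d i / c)| ≤ 2.4 := by
      rw [abs_div, abs_neg, abs_of_pos hc0, div_le_iff₀ hc0]
      have : (1 : ℝ) ≤ 2.4 * c := by rw [div_le_iff₀ (by norm_num)] at hc; linarith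
      linarith [hd i hi]
    have h2 := mul_le_mul_of_nonneg_left (exp_le_one_add_add_two_mul_sq h1) (hr.pos i hi).le
    have h3 : d i ^ 2 ≤ |d i| := by
      rw [← sq_abs]
      nlinarith [abs_nonneg (d i), hd i hi]
    have h4 : r i * (1 + -d i / c + 2 * (-d i / c) ^ 2) =
        r i - r i * d i / c + 2 / c ^ 2 * (r i * d i ^ 2) := by
      field_simp
      ring
    have h5 := mul_le_mul_of_nonneg_left (mul_le_mul_of_nonneg_left h3 (hr.pos i hi).le)
      (by positivity : 0 ≤ 2 / c ^ 2)
    linarith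
  have hsum := Finset.sum_le_sum hexp
  rw [Finset.sum_add_distrib, Finset.sum_sub_distrib, hr.sum_eq, ← Finset.mul_sum,
    ← Finset.sum_div] at hsum
  have h6 : ∑ i ∈ V, -d i / c * s i = -(∑ i ∈ V, d i * s i) / c := by
    rw [← Finset.sum_neg_distrib, Finset.sum_div]
    exact Finset.sum_congr rfl fun i _ => by ring
  have h7 : ∑ i ∈ V, r i * d i = ∑ i ∈ V, d i * r i := Finset.sum_congr rfl fun i _ => by ring
  rw [h6] at hF
  rw [h7] at hsum
  have h8 := mul_le_mul_of_nonneg_left hρ (by positivity : 0 ≤ 2 / c ^ 2)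
  have h9 : (∑ i ∈ V, d i * r i) / c - (∑ i ∈ V, d i * s i) / c ≤
      relEntropyOn V s r + 2 / c ^ 2 * ρ := by
    have : -(∑ i ∈ V, d i * s i) / c = -((∑ i ∈ V, d i * s i) / c) := neg_div _ _
    linarith
  have h10 := mul_le_mul_of_nonneg_left h9 hc0.le
  have h11 : ∑ i ∈ V, d i * (r i - s i) = ∑ i ∈ V, d i * r i - ∑ i ∈ V, d i * s i := by
    rw [← Finset.sum_sub_distrib]
    exact Finset.sum_congr rfl fun i _ => by ring
  rw [h11]
  calc ∑ i ∈ V, d i * r i - ∑ i ∈ V, d i * s i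
      = c * ((∑ i ∈ V, d i * r i) / c - (∑ i ∈ V, d i * s i) / c) := by field_simp
    _ ≤ c * (relEntropyOn V s r + 2 / c ^ 2 * ρ) := h10
    _ = c * relEntropyOn V s r + 2 * ρ / c := by field_simp

/-- The stability of the played clique, in terms of a bound `ρ` on the conditional mean of the
absolute losses. -/
lemma stability_le_of_le_mul_sqrt (hV : V.Nonempty) (hp : ∀ i ∈ V, 0 < p i)
    (hq : ∀ i ∈ V, 0 < q i) (hL : ∀ i ∈ V, -L ≤ Real.log (condProb V p i)) (hL12 : 12 ≤ L)
    (hα : 2 * (L ^ 2 + 1) ≤ α) (hd : ∀ i ∈ V, |d i| ≤ 1)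
    (hρ : ∑ i ∈ V, condProb V p i * |d i| ≤ ρ) (hρ1 : ρ ≤ 1) (hw0 : 0 < w)
    (hw : 0.85 ≤ w * √(∑ i ∈ V, p i)) :
    ∑ i ∈ V, d i / (∑ j ∈ V, p j) * (p i - q i) - w * potentialDivergence α V q p ≤
      7 * ρ / (w * √(∑ i ∈ V, p i)) := by
  have hr := isPosProb_condProb hV hp
  have hs := isPosProb_condProb hV hq
  have hP := Finset.sum_pos hp hV
  have hQ := Finset.sum_pos hq hV
  have hρ0 : 0 ≤ ρ := (Finset.sum_nonneg fun i hi =>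
    mul_nonneg (hr.pos i hi).le (abs_nonneg _)).trans hρ
  have hD := mul_le_mul_of_nonneg_left (le_potentialDivergence hV hp hq hL hL12 hα) hw0.le
  have hF := sum_mul_sub_le_relEntropyOn hr hs hd hρ
    (c := w * √(∑ i ∈ V, p i) / 2) (by norm_num at hw ⊢; linarith)
  have hm : |∑ i ∈ V, d i * condProb V p i| ≤ ρ := by
    refine (Finset.abs_sum_le_sum_abs _ _).trans ((Finset.sum_le_sum fun i hi => ?_).trans hρ)
    rw [abs_mul, abs_of_pos (hr.pos i hi), mul_comm]
  set r := condProb V p with hrdef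
  set s := condProb V q with hsdef
  set KL := relEntropyOn V s r
  have hKL : 0 ≤ KL := relEntropyOn_nonneg hr hs
  set a := √(∑ i ∈ V, p i) with ha
  set b := √(∑ i ∈ V, q i) with hb
  have ha0 : 0 < a := Real.sqrt_pos.2 hP
  have hPa : ∑ i ∈ V, p i = a ^ 2 := (Real.sq_sqrt hP.le).symm
  have hQb : ∑ i ∈ V, q i = b ^ 2 := (Real.sq_sqrt hQ.le).symm
  obtain ⟨v, hv⟩ : ∃ v, b = a * (1 + v) := ⟨b / a - 1, by field_simp; ring⟩
  -- separate the change of the mass from the change of the conditional distribution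
  have hlin : ∑ i ∈ V, d i / (∑ j ∈ V, p j) * (p i - q i) =
      (1 - (1 + v) ^ 2) * ∑ i ∈ V, d i * r i + (1 + v) ^ 2 * ∑ i ∈ V, d i * (r i - s i) := by
    rw [Finset.mul_sum, Finset.mul_sum, ← Finset.sum_add_distrib]
    refine Finset.sum_congr rfl fun i _ => ?_
    have e1 : p i = a ^ 2 * r i := by rw [← hPa, sum_mul_condProb hV hp]
    have e2 : q i = a ^ 2 * (1 + v) ^ 2 * s i := by
      rw [← mul_pow, ← hv, ← hQb, sum_mul_condProb hV hq]
    rw [e1, e2, hPa]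
    field_simp
    ring
  rw [hlin]
  set m := ∑ i ∈ V, d i * r i
  set X := ∑ i ∈ V, d i * (r i - s i)
  set u := w * a with hu
  have hu0 : 0 < u := by positivity
  have hD' : w * (1 / a * (b ^ 2 / 2 * KL + 20 * (b - a) ^ 2)) =
      (1 + v) ^ 2 * (u / 2 * KL) + 20 * u * v ^ 2 := by
    rw [hv, hu]
    field_simp
    ring
  rw [hD'] at hD
  have hX := mul_le_mul_of_nonneg_left hF (sq_nonneg (1 + v))
  have e4 : 2 * ρ / (u / 2) = ρ * (4 / u) := by field_simp; ring
  rw [e4] at hX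
  clear_value m X u KL
  have hz : 4 / u ≤ 4.75 := by
    rw [div_le_iff₀ hu0]; norm_num at hw ⊢; linarith
  have hz0 : 0 < 4 / u := by positivity
  have hm2 : (1 - (1 + v) ^ 2) * m ≤ ρ * (2 * |v| + v ^ 2) := by
    have e5 : |1 - (1 + v) ^ 2| ≤ 2 * |v| + v ^ 2 := by
      rw [show 1 - (1 + v) ^ 2 = -(2 * v) - v ^ 2 by ring]
      refine (abs_sub _ _).trans ?_
      rw [abs_neg, abs_mul, abs_pow, sq_abs]
      norm_num
    calc (1 - (1 + v) ^ 2) * m ≤ |1 - (1 + v) ^ 2| * |m| := by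
          rw [← abs_mul]; exact le_abs_self _
      _ ≤ (2 * |v| + v ^ 2) * ρ := mul_le_mul e5 hm (abs_nonneg _) (by positivity)
      _ = _ := mul_comm _ _
  have hy2 : (1 + v) ^ 2 * (ρ * (4 / u)) ≤ ρ * (4 / u) + ρ * (4.75 * (2 * |v| + v ^ 2)) := by
    have e6 : (1 + v) ^ 2 ≤ 1 + (2 * |v| + v ^ 2) := by linarith [le_abs_self v]
    have e7 : 0 ≤ 2 * |v| + v ^ 2 := by positivity
    have e8 := mul_le_mul_of_nonneg_left hz e7
    have e9 := mul_le_mul_of_nonneg_right e6 hz0.le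
    have e10 := mul_le_mul_of_nonneg_left (e9.trans (by linarith :
      (1 + (2 * |v| + v ^ 2)) * (4 / u) ≤ 4 / u + 4.75 * (2 * |v| + v ^ 2))) hρ0
    linarith
  have hv2 : v ^ 2 = |v| ^ 2 := (sq_abs v).symm
  have hgoal : ρ * (5.75 * (2 * |v| + v ^ 2)) - 20 * u * v ^ 2 ≤ ρ * (3 / u) := by
    rw [hv2]
    have hn := abs_nonneg v
    generalize |v| = n at hn
    rw [mul_div_assoc', le_div_iff₀ hu0]
    have g1 : u * n ^ 2 ≤ 1.2 * (u * n) ^ 2 := by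
      have : 0.85 ≤ u := hw
      have := mul_le_mul_of_nonneg_left (by norm_num at this ⊢; linarith : 1 ≤ 1.2 * u)
        (by positivity : 0 ≤ u * n ^ 2)
      linarith
    have g2 : ρ * (u * n ^ 2) ≤ u * n ^ 2 := mul_le_of_le_one_left (by positivity) hρ1
    have g3 : ρ ^ 2 ≤ ρ := pow_le_of_le_one hρ0 hρ1 two_ne_zero
    have g4 := sq_nonneg (13 * (u * n) - 5.75 * ρ)
    linarith [sq_nonneg (u * n)]
  have e11 : 7 * ρ / u = ρ * (4 / u) + ρ * (3 / u) := by field_simp; ring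
  rw [e11]
  rw [mul_add] at hX
  linarith

/-- The stability of the played clique for nonnegative losses. -/
lemma stability_le_of_nonneg (hV : V.Nonempty) (hp : ∀ i ∈ V, 0 < p i)
    (hq : ∀ i ∈ V, 0 < q i) (hL : ∀ i ∈ V, -L ≤ Real.log (condProb V p i)) (hL12 : 12 ≤ L)
    (hα : 2 * (L ^ 2 + 1) ≤ α) (hd : ∀ i ∈ V, d i ∈ Set.Icc (0 : ℝ) 1) (hw0 : 0 < w) :
    ∑ i ∈ V, d i / (∑ j ∈ V, p j) * (p i - q i) - w * potentialDivergence α V q p ≤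
      7 / (w * √(∑ i ∈ V, p i)) := by
  have hr := isPosProb_condProb hV hp
  have hP := Finset.sum_pos hp hV
  have habs : ∀ i ∈ V, |d i| ≤ 1 := fun i hi => by rw [abs_of_nonneg (hd i hi).1]; exact (hd i hi).2
  have hρ : ∑ i ∈ V, condProb V p i * |d i| ≤ 1 := by
    rw [← hr.sum_eq]
    exact Finset.sum_le_sum fun i hi => mul_le_of_le_one_right (hr.pos i hi).le (habs i hi)
  rcases le_total 1 (w * √(∑ i ∈ V, p i)) with h | h
  · have := stability_le_of_le_mul_sqrt hV hp hq hL hL12 hα habs hρ le_rfl hw0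
      (le_trans (by norm_num) h)
    rwa [mul_one] at this
  · -- here the trivial bound by the conditional mean of the loss suffices
    have hD := mul_nonneg hw0.le (potentialDivergence_nonneg hV hp hq hL hL12 hα)
    have h1 : ∑ i ∈ V, d i / (∑ j ∈ V, p j) * (p i - q i) ≤ ∑ i ∈ V, condProb V p i * |d i| := by
      refine Finset.sum_le_sum fun i hi => ?_
      rw [abs_of_nonneg (hd i hi).1, condProb, div_mul_eq_mul_div, div_mul_eq_mul_div, mul_comm (p i)]
      exact div_le_div_of_nonneg_right
        (mul_le_mul_of_nonneg_left (by linarith [hq i hi]) (hd i hi).1) hP.le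
    have h2 : 7 ≤ 7 / (w * √(∑ i ∈ V, p i)) := by
      rw [le_div_iff₀ (mul_pos hw0 (Real.sqrt_pos.2 hP))]
      linarith
    linarith

/-- The stability of a clique on which the shifted loss is a negative constant. -/
lemma stability_const_le (hV : V.Nonempty) (hp : ∀ i ∈ V, 0 < p i)
    (hq : ∀ i ∈ V, 0 < q i) (hL : ∀ i ∈ V, -L ≤ Real.log (condProb V p i)) (hL12 : 12 ≤ L)
    (hα : 2 * (L ^ 2 + 1) ≤ α) (hP1 : ∑ i ∈ V, p i ≤ 1) {x : ℝ} (hx : x ∈ Set.Icc (0 : ℝ) 2)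
    (hw : 1 ≤ w) :
    ∑ i ∈ V, -x * (p i - q i) - w * potentialDivergence α V q p ≤ √(∑ i ∈ V, p i) / w := by
  have hP := Finset.sum_pos hp hV
  have hQ := Finset.sum_pos hq hV
  have hw0 : 0 < w := by linarith
  have hKL := relEntropyOn_nonneg (isPosProb_condProb hV hp) (isPosProb_condProb hV hq)
  have hD := mul_le_mul_of_nonneg_left (le_potentialDivergence hV hp hq hL hL12 hα) hw0.le
  rw [← Finset.mul_sum, Finset.sum_sub_distrib]
  have hPa : ∑ i ∈ V, p i = √(∑ i ∈ V, p i) ^ 2 := (Real.sq_sqrt hP.le).symm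
  have hQb : ∑ i ∈ V, q i = √(∑ i ∈ V, q i) ^ 2 := (Real.sq_sqrt hQ.le).symm
  have ha0 : 0 < √(∑ i ∈ V, p i) := Real.sqrt_pos.2 hP
  have ha1 : √(∑ i ∈ V, p i) ≤ 1 := Real.sqrt_le_one.2 hP1
  generalize relEntropyOn V (condProb V q) (condProb V p) = KL at *
  generalize √(∑ i ∈ V, p i) = a at *
  generalize √(∑ i ∈ V, q i) = b at *
  rw [hPa, hQb]
  obtain ⟨v, rfl⟩ : ∃ v, b = a * (1 + v) := ⟨b / a - 1, by field_simp; ring⟩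
  have h1 : w * (1 / a * (20 * (a * (1 + v) - a) ^ 2)) ≤ w * potentialDivergence α V q p := by
    refine le_trans (mul_le_mul_of_nonneg_left (mul_le_mul_of_nonneg_left ?_ (by positivity))
      hw0.le) hD
    have : 0 ≤ (a * (1 + v)) ^ 2 / 2 * KL := by positivity
    linarith
  have h2 : w * (1 / a * (20 * (a * (1 + v) - a) ^ 2)) = 20 * (w * a * v ^ 2) := by
    field_simp; ring
  have h3 : -x * (a ^ 2 - (a * (1 + v)) ^ 2) - 20 * (w * a * v ^ 2) ≤ a / w := by
    rw [le_div_iff₀ hw0]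
    have e1 : x * (a * (w * v)) * 2 ≤ 1 + 4 * (w * v) ^ 2 := by
      have := sq_nonneg (x * a / 2 - 2 * (w * v))
      have e2 : (x * a / 2) ^ 2 ≤ 1 := by
        have : x * a / 2 ≤ 1 := by nlinarith [hx.1, hx.2]
        have : 0 ≤ x * a / 2 := by have := hx.1; positivity
        nlinarith
      nlinarith
    have e3 : x * a * v ^ 2 * w ≤ 2 * (w * v) ^ 2 := by
      have : x * a ≤ 2 * w := by nlinarith [hx.1, hx.2]
      nlinarith [mul_le_mul_of_nonneg_right this (by positivity : 0 ≤ w * v ^ 2)]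
    nlinarith [mul_le_mul_of_nonneg_left (add_le_add e1 e3) ha0.le,
      mul_nonneg ha0.le (sq_nonneg (w * v))]
  linarith

end Stability

/-! ### First-order optimality of the predictions -/

/-- The members of the clique `V_k`. -/
abbrev cliqueSet {N K : ℕ} (c : Fin N → Fin K) (k : Fin K) : Finset (Fin N) := {i | c i = k}

/-- The objective of a round: the cumulative loss `x` plus the regularizer `w Ψ_α + Φ`. -/
noncomputable def ftrlObjective {N K : ℕ} (α w : ℝ) (c : Fin N → Fin K) (x q : Fin N → ℝ) : ℝ :=
  ∑ i, x i * q i + (w * tsallisShannon α c q + cliqueLogBarrier 9 c q)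

lemma nonneg_of_hasDerivAt_of_forall_le {g : ℝ → ℝ} {g' : ℝ} (hg : HasDerivAt g g' 0)
    (hmin : ∀ x ∈ Set.Ioc (0 : ℝ) 1, g 0 ≤ g x) : 0 ≤ g' := by
  refine ge_of_tendsto hg.tendsto_slope_zero_right ?_
  have h1 : Set.Ioc (0 : ℝ) 1 ∈ nhdsWithin 0 (Set.Ioi 0) := Ioc_mem_nhdsGT one_pos
  filter_upwards [h1] with t ht
  rw [zero_add, smul_eq_mul]
  exact mul_nonneg (inv_nonneg.2 ht.1.le) (sub_nonneg.2 (hmin t ht))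

section Simplex

variable {N K : ℕ} {c : Fin N → Fin K} {p q : Fin N → ℝ} {γ L α w : ℝ}

lemma convex_truncatedSimplex : Convex ℝ (truncatedSimplex N γ) := by
  intro p hp q hq a b ha hb hab
  refine ⟨convex_stdSimplex ℝ (Fin N) hp.1 hq.1 ha hb hab, fun i => ?_⟩
  have h1 := mul_le_mul_of_nonneg_left (hp.2 i) ha
  have h2 := mul_le_mul_of_nonneg_left (hq.2 i) hb
  have h3 : (a + b) * γ = γ := by rw [hab, one_mul]
  simp only [Pi.add_apply, Pi.smul_apply, smul_eq_mul]
  linarith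

lemma sum_cliqueMass (c : Fin N → Fin K) (p : Fin N → ℝ) : ∑ k, cliqueMass c p k = ∑ i, p i :=
  Finset.sum_fiberwise _ _ _

lemma cliqueSet_nonempty (hc : Function.Surjective c) (k : Fin K) : (cliqueSet c k).Nonempty := by
  obtain ⟨i, hi⟩ := hc k
  exact ⟨i, by simp [hi]⟩

lemma tsallisShannon_eq_sum (α : ℝ) (c : Fin N → Fin K) (p : Fin N → ℝ) :
    tsallisShannon α c p = ∑ k, cliquePotential α (cliqueSet c k) p := by
  rw [tsallisShannon, Finset.mul_sum, ← Finset.sum_add_distrib]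
  refine Finset.sum_congr rfl fun k _ => ?_
  rw [cliquePotential, cliqueMass]

lemma pos_of_mem_truncatedSimplex (hγ : 0 < γ) (hp : p ∈ truncatedSimplex N γ) (i : Fin N) :
    0 < p i := hγ.trans_le (hp.2 i)

lemma cliqueMass_pos (hc : Function.Surjective c) (hγ : 0 < γ) (hp : p ∈ truncatedSimplex N γ)
    (k : Fin K) : 0 < cliqueMass c p k :=
  Finset.sum_pos (fun i _ => pos_of_mem_truncatedSimplex hγ hp i) (cliqueSet_nonempty hc k)

lemma cliqueMass_le_one (hp : p ∈ truncatedSimplex N γ) (k : Fin K) : cliqueMass c p k ≤ 1 := by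
  rw [← hp.1.2]
  exact Finset.sum_le_sum_of_subset_of_nonneg (Finset.subset_univ _) fun i _ _ => hp.1.1 i

lemma le_cliqueMass (hp : p ∈ truncatedSimplex N γ) (i : Fin N) : p i ≤ cliqueMass c p (c i) :=
  Finset.single_le_sum (fun j _ => hp.1.1 j) (by simp)

lemma neg_le_log_condProb (hγ : 0 < γ) (hL : -L ≤ Real.log γ) (hp : p ∈ truncatedSimplex N γ)
    (k : Fin K) : ∀ i ∈ cliqueSet c k, -L ≤ Real.log (condProb (cliqueSet c k) p i) := by
  intro i hi
  refine hL.trans (Real.log_le_log hγ ?_)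
  have h0 : 0 < ∑ j ∈ cliqueSet c k, p j :=
    Finset.sum_pos (fun i _ => pos_of_mem_truncatedSimplex hγ hp i) ⟨i, hi⟩
  rw [condProb, le_div_iff₀ h0]
  have h1 : ∑ j ∈ cliqueSet c k, p j ≤ 1 := cliqueMass_le_one hp k
  exact (mul_le_of_le_one_right hγ.le h1).trans (hp.2 i)

lemma hasDerivAt_cliqueLogBarrier (hP : ∀ k, 0 < cliqueMass c p k) :
    HasDerivAt (fun x : ℝ => cliqueLogBarrier 9 c (fun i => p i + x * (q i - p i)))
      (-9 * ∑ k, (cliqueMass c q k - cliqueMass c p k) / cliqueMass c p k) 0 := by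
  have hmass : ∀ k, HasDerivAt (fun x : ℝ => cliqueMass c (fun i => p i + x * (q i - p i)) k)
      (cliqueMass c q k - cliqueMass c p k) 0 := fun k => by
    unfold cliqueMass
    rw [← Finset.sum_sub_distrib]
    exact HasDerivAt.fun_sum fun i _ => by
      simpa using ((hasDerivAt_id (0 : ℝ)).mul_const (q i - p i)).const_add (p i)
  have h0 : ∀ k, cliqueMass c (fun i => p i + 0 * (q i - p i)) k = cliqueMass c p k := by simp
  refine (HasDerivAt.const_mul (-9 : ℝ) (HasDerivAt.fun_sum fun k _ =>
    (hmass k).log (by rw [h0]; exact (hP k).ne'))).congr_deriv ?_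
  simp only [h0]

lemma cliqueLogBarrier_ge (hP : ∀ k, 0 < cliqueMass c p k) (hQ : ∀ k, 0 < cliqueMass c q k) :
    cliqueLogBarrier 9 c p +
      -9 * ∑ k, (cliqueMass c q k - cliqueMass c p k) / cliqueMass c p k ≤
        cliqueLogBarrier 9 c q := by
  have h : ∑ k, (Real.log (cliqueMass c q k) - Real.log (cliqueMass c p k)) ≤
      ∑ k, (cliqueMass c q k - cliqueMass c p k) / cliqueMass c p k := by
    refine Finset.sum_le_sum fun k _ => ?_
    rw [← Real.log_div (hQ k).ne' (hP k).ne', sub_div, div_self (hP k).ne']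
    exact Real.log_le_sub_one_of_pos (div_pos (hQ k) (hP k))
  rw [Finset.sum_sub_distrib] at h
  rw [cliqueLogBarrier, cliqueLogBarrier]
  linarith

/-- At a minimizer `p` of the objective, the objective grows at least like the Bregman divergences
of the clique potentials: the directional derivatives are nonnegative and the log-barrier is
convex. -/
lemma ftrlObjective_ge (hc : Function.Surjective c) (hγ : 0 < γ) {x : Fin N → ℝ}
    (hp : p ∈ truncatedSimplex N γ)
    (hmin : IsMinOn (ftrlObjective α w c x) (truncatedSimplex N γ) p)
    (hq : q ∈ truncatedSimplex N γ) :
    ftrlObjective α w c x p + w * ∑ k, potentialDivergence α (cliqueSet c k) q p ≤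
      ftrlObjective α w c x q := by
  have hlin : HasDerivAt (fun y : ℝ => ∑ i, x i * (p i + y * (q i - p i)))
      (∑ i, x i * (q i - p i)) 0 :=
    HasDerivAt.fun_sum fun i _ => by
      simpa using (((hasDerivAt_id (0 : ℝ)).mul_const (q i - p i)).const_add (p i)).const_mul (x i)
  have hpot : HasDerivAt (fun y : ℝ => tsallisShannon α c (fun i => p i + y * (q i - p i)))
      (∑ k, potentialDeriv α (cliqueSet c k) p q) 0 := by
    simp only [tsallisShannon_eq_sum]
    exact HasDerivAt.fun_sum fun k _ => hasDerivAt_cliquePotential (cliqueSet_nonempty hc k)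
      fun i _ => pos_of_mem_truncatedSimplex hγ hp i
  have hbar := hasDerivAt_cliqueLogBarrier (c := c) (q := q) (cliqueMass_pos hc hγ hp)
  have hderiv := hlin.add ((hpot.const_mul w).add hbar)
  have h0 := nonneg_of_hasDerivAt_of_forall_le hderiv fun y hy => by
    have hmem : (fun i => p i + y * (q i - p i)) ∈ truncatedSimplex N γ := by
      have := convex_truncatedSimplex hp hq (sub_nonneg.2 hy.2) hy.1.le (by ring)
      convert this using 1
      funext i
      simp only [Pi.add_apply, Pi.smul_apply, smul_eq_mul]
      ring
    have h := hmin hmem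
    simp only [Set.mem_ofPred_eq, ftrlObjective] at h
    simpa using h
  have hB := cliqueLogBarrier_ge (cliqueMass_pos hc hγ hp) (cliqueMass_pos hc hγ hq)
  have hD : ∑ k, potentialDivergence α (cliqueSet c k) q p = tsallisShannon α c q -
      tsallisShannon α c p - ∑ k, potentialDeriv α (cliqueSet c k) p q := by
    rw [tsallisShannon_eq_sum, tsallisShannon_eq_sum, ← Finset.sum_sub_distrib,
      ← Finset.sum_sub_distrib]
    rfl
  have hx : ∑ i, x i * (q i - p i) = ∑ i, x i * q i - ∑ i, x i * p i := by
    rw [← Finset.sum_sub_distrib]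
    exact Finset.sum_congr rfl fun i _ => by ring
  rw [hx] at h0
  rw [hD, ftrlObjective, ftrlObjective]
  linarith

lemma potentialDivergence_cliqueSet_nonneg (hc : Function.Surjective c) (hγ : 0 < γ)
    (hL : -L ≤ Real.log γ) (hL12 : 12 ≤ L) (hα : 2 * (L ^ 2 + 1) ≤ α)
    (hp : p ∈ truncatedSimplex N γ) (hq : q ∈ truncatedSimplex N γ) (k : Fin K) :
    0 ≤ potentialDivergence α (cliqueSet c k) q p :=
  potentialDivergence_nonneg (cliqueSet_nonempty hc k)
    (fun i _ => pos_of_mem_truncatedSimplex hγ hp i)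
    (fun i _ => pos_of_mem_truncatedSimplex hγ hq i) (neg_le_log_condProb hγ hL hp k) hL12 hα

/-- Predictions are unique, because the Bregman divergences vanish only on the diagonal. -/
lemma ftrlObjective_minimizer_unique (hc : Function.Surjective c) (hγ : 0 < γ)
    (hL : -L ≤ Real.log γ) (hL12 : 12 ≤ L) (hα : 2 * (L ^ 2 + 1) ≤ α) (hw : 0 < w)
    {x : Fin N → ℝ} (hp : p ∈ truncatedSimplex N γ)
    (hpmin : IsMinOn (ftrlObjective α w c x) (truncatedSimplex N γ) p)
    (hq : q ∈ truncatedSimplex N γ)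
    (hqmin : IsMinOn (ftrlObjective α w c x) (truncatedSimplex N γ) q) : q = p := by
  have h1 := ftrlObjective_ge hc hγ hp hpmin hq
  have h2 : ftrlObjective α w c x q ≤ ftrlObjective α w c x p := hqmin hp
  have h3 := nonpos_of_mul_nonpos_right (by linarith :
    w * ∑ k, potentialDivergence α (cliqueSet c k) q p ≤ 0) hw
  have hD := potentialDivergence_cliqueSet_nonneg hc hγ hL hL12 hα hp hq
  have h4 := (Finset.sum_eq_zero_iff_of_nonneg fun k _ => hD k).1
    (le_antisymm h3 (Finset.sum_nonneg fun k _ => hD k))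
  funext i
  exact eq_of_potentialDivergence_nonpos (cliqueSet_nonempty hc (c i))
    (fun i _ => pos_of_mem_truncatedSimplex hγ hp i)
    (fun i _ => pos_of_mem_truncatedSimplex hγ hq i) (neg_le_log_condProb hγ hL hp (c i)) hL12 hα
    (h4 (c i) (Finset.mem_univ _)).le i (by simp)

/-! ### Stability of one round -/

/-- The mass of the clique `V_k` without the arm `istar`. -/
noncomputable def residualMass (c : Fin N → Fin K) (istar : Fin N) (p : Fin N → ℝ) (k : Fin K) :
    ℝ := ∑ i with c i = k ∧ i ≠ istar, p i

lemma residualMass_of_ne {istar : Fin N} {k : Fin K} (hk : k ≠ c istar) :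
    residualMass c istar p k = cliqueMass c p k := by
  refine Finset.sum_congr (Finset.filter_congr fun i _ => ⟨fun h => h.1, fun h => ⟨h, ?_⟩⟩)
    fun _ _ => rfl
  rintro rfl
  exact hk h.symm

lemma residualMass_self (istar : Fin N) :
    residualMass c istar p (c istar) = cliqueMass c p (c istar) - p istar := by
  classical
  have h : (Finset.univ.filter fun i => c i = c istar ∧ i ≠ istar) =
      (cliqueSet c (c istar)).erase istar := by
    ext i; simp [and_comm]
  rw [residualMass, h, cliqueMass, ← Finset.add_sum_erase (cliqueSet c (c istar)) p (a := istar)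
    (by simp)]
  ring

lemma residualMass_nonneg (hp : p ∈ truncatedSimplex N γ) (istar : Fin N) (k : Fin K) :
    0 ≤ residualMass c istar p k := Finset.sum_nonneg fun i _ => hp.1.1 i

lemma residualMass_le (hp : p ∈ truncatedSimplex N γ) (istar : Fin N) (k : Fin K) :
    residualMass c istar p k ≤ cliqueMass c p k :=
  Finset.sum_le_sum_of_subset_of_nonneg
    (Finset.monotone_filter_right _ fun _ _ h => h.1) fun i _ _ => hp.1.1 i

open Classical in
/-- The bound on the stability of a round in which the arm `j` is played.  When the clique of
`istar` is played and has a large mass, the loss estimates may be shifted by the estimate of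
`istar`, so that the bound becomes small if `p` is concentrated on `istar`. -/
noncomputable def stabilityBound (c : Fin N → Fin K) (istar : Fin N) (w : ℝ) (p : Fin N → ℝ)
    (j : Fin N) : ℝ :=
  if 3 / 4 ≤ cliqueMass c p (c istar) ∧ c j = c istar then
    7 * (1 - p istar / cliqueMass c p (c istar)) / (w * √(cliqueMass c p (c istar))) +
      ∑ k ∈ Finset.univ.erase (c istar), √(cliqueMass c p k) / w
  else 7 / (w * √(cliqueMass c p (c j)))

/-- The importance-weighted loss estimate, in terms of the true loss vector. -/
noncomputable def weightedLoss (c : Fin N → Fin K) (p : Fin N → ℝ) (j : Fin N) (l : Fin N → ℝ)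
    (i : Fin N) : ℝ := if c i = c j then l i / cliqueMass c p (c i) else 0

lemma sum_weightedLoss_mul (j : Fin N) (l f : Fin N → ℝ) :
    ∑ i, weightedLoss c p j l i * f i =
      ∑ i ∈ cliqueSet c (c j), l i / (∑ m ∈ cliqueSet c (c j), p m) * f i := by
  rw [Finset.sum_filter]
  refine Finset.sum_congr rfl fun i _ => ?_
  unfold weightedLoss
  split_ifs with h
  · rw [cliqueMass, h]
  · rw [zero_mul]

/-- The stability of a round.  In the first case of `stabilityBound` a constant is subtracted from
all loss estimates, which changes nothing because `p` and `q` have the same total mass. -/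
lemma sum_mul_sub_le_stabilityBound (hc : Function.Surjective c) (hγ : 0 < γ)
    (hL : -L ≤ Real.log γ) (hL12 : 12 ≤ L) (hα : 2 * (L ^ 2 + 1) ≤ α) (hw : 1 ≤ w)
    (hp : p ∈ truncatedSimplex N γ) (hq : q ∈ truncatedSimplex N γ) {l : Fin N → ℝ}
    (hl : ∀ i, l i ∈ Set.Icc (0 : ℝ) 1) (istar j : Fin N) :
    ∑ i, weightedLoss c p j l i * (p i - q i) -
      w * ∑ k, potentialDivergence α (cliqueSet c k) q p ≤ stabilityBound c istar w p j := by
  have hV := cliqueSet_nonempty hc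
  have hw0 : 0 < w := by linarith
  have hp0 : ∀ k, ∀ i ∈ cliqueSet c k, 0 < p i := fun _ i _ => pos_of_mem_truncatedSimplex hγ hp i
  have hq0 : ∀ k, ∀ i ∈ cliqueSet c k, 0 < q i := fun _ i _ => pos_of_mem_truncatedSimplex hγ hq i
  have hlog := neg_le_log_condProb (c := c) hγ hL hp
  have hD := potentialDivergence_cliqueSet_nonneg hc hγ hL hL12 hα hp hq
  unfold stabilityBound
  split_ifs with h
  · obtain ⟨hP, hj⟩ := h
    set P := cliqueMass c p (c istar) with hPdef
    have hP0 : 0 < P := by linarith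
    -- shift the estimates by the constant `l istar / P`
    have hshift : ∑ i, weightedLoss c p j l i * (p i - q i) =
        ∑ k, ∑ i ∈ cliqueSet c k, (weightedLoss c p j l i - l istar / P) * (p i - q i) := by
      rw [Finset.sum_fiberwise]
      have : ∑ i, l istar / P * (p i - q i) = 0 := by
        rw [← Finset.mul_sum, Finset.sum_sub_distrib, hp.1.2, hq.1.2, sub_self, mul_zero]
      rw [← sub_eq_zero, ← Finset.sum_sub_distrib, ← this]
      exact Finset.sum_congr rfl fun i _ => by ring
    rw [hshift, Finset.mul_sum, ← Finset.sum_sub_distrib,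
      ← Finset.add_sum_erase _ _ (Finset.mem_univ (c istar))]
    refine add_le_add ?_ (Finset.sum_le_sum fun k hk => ?_)
    · have h1 : ∑ i ∈ cliqueSet c (c istar), (weightedLoss c p j l i - l istar / P) * (p i - q i) =
          ∑ i ∈ cliqueSet c (c istar),
            (l i - l istar) / (∑ m ∈ cliqueSet c (c istar), p m) * (p i - q i) := by
        refine Finset.sum_congr rfl fun i hi => ?_
        have hi' : c i = c istar := by simpa using hi
        rw [weightedLoss, if_pos (hi'.trans hj.symm), hi', sub_div]
        rfl
      rw [h1]
      have hd : ∀ i ∈ cliqueSet c (c istar), |l i - l istar| ≤ 1 := fun i _ => by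
        rw [abs_le]
        constructor <;> linarith [(hl i).1, (hl i).2, (hl istar).1, (hl istar).2]
      have hr := isPosProb_condProb (hV (c istar)) (hp0 _)
      have hmem : istar ∈ cliqueSet c (c istar) := by simp
      refine stability_le_of_le_mul_sqrt (hV _) (hp0 _) (hq0 _) (hlog _) hL12 hα hd ?_ ?_ hw0 ?_
      · have h2 := hr.sum_eq
        rw [← Finset.add_sum_erase _ _ hmem] at h2 ⊢
        rw [sub_self, abs_zero, mul_zero, zero_add]
        have h3 : p istar / P = condProb (cliqueSet c (c istar)) p istar := rfl
        rw [h3, ← h2, add_sub_cancel_left]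
        exact Finset.sum_le_sum fun i hi => mul_le_of_le_one_right
          (hr.pos i (Finset.mem_of_mem_erase hi)).le (hd i (Finset.mem_of_mem_erase hi))
      · have := div_nonneg (hp.1.1 istar) hP0.le
        linarith
      · have h4 : (0.85 : ℝ) ≤ √P := Real.le_sqrt_of_sq_le (by norm_num; linarith)
        have h5 : (0.85 : ℝ) ≤ w * √P := by nlinarith
        exact h5
    · have h1 : ∑ i ∈ cliqueSet c k, (weightedLoss c p j l i - l istar / P) * (p i - q i) =
          ∑ i ∈ cliqueSet c k, -(l istar / P) * (p i - q i) := by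
        refine Finset.sum_congr rfl fun i hi => ?_
        have hi' : c i = k := by simpa using hi
        rw [weightedLoss, if_neg (by rw [hi', hj]; exact Finset.ne_of_mem_erase hk), zero_sub]
      rw [h1]
      refine stability_const_le (hV _) (hp0 _) (hq0 _) (hlog _) hL12 hα (cliqueMass_le_one hp k)
        ⟨div_nonneg (hl istar).1 hP0.le, ?_⟩ hw
      rw [div_le_iff₀ hP0]
      linarith [(hl istar).2]
  · rw [sum_weightedLoss_mul]
    have h1 := stability_le_of_nonneg (hV (c j)) (hp0 _) (hq0 _) (hlog _) hL12 hα
      (fun i _ => hl i) hw0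
    have h2 := mul_le_mul_of_nonneg_left
      (Finset.single_le_sum (fun k _ => hD k) (Finset.mem_univ (c j))) hw0.le
    exact le_trans (by linarith) h1

lemma stabilityBound_nonneg (hw : 0 < w) (hp : p ∈ truncatedSimplex N γ) (istar j : Fin N) :
    0 ≤ stabilityBound c istar w p j := by
  unfold stabilityBound
  split_ifs with h
  · have h1 : p istar / cliqueMass c p (c istar) ≤ 1 :=
      div_le_one_of_le₀ (le_cliqueMass hp istar) (by linarith [h.1])
    have h2 : 0 ≤ 1 - p istar / cliqueMass c p (c istar) := by linarith
    positivity
  · positivity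

/-- The stability bound, averaged over the arm. -/
lemma sum_mul_stabilityBound_le (hc : Function.Surjective c) (hγ : 0 < γ) (hw : 0 < w)
    (hp : p ∈ truncatedSimplex N γ) (istar : Fin N) :
    ∑ j, p j * stabilityBound c istar w p j ≤
      35 / w * ∑ k, √(residualMass c istar p k) := by
  have hmass := cliqueMass_pos hc hγ hp
  have hsplit : ∑ k, √(residualMass c istar p k) = √(residualMass c istar p (c istar)) +
      ∑ k ∈ Finset.univ.erase (c istar), √(cliqueMass c p k) := by
    rw [← Finset.add_sum_erase _ _ (Finset.mem_univ (c istar))]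
    congr 1
    exact Finset.sum_congr rfl fun k hk => by rw [residualMass_of_ne (Finset.ne_of_mem_erase hk)]
  have hother : ∀ k, (cliqueMass c p k) * (7 / (w * √(cliqueMass c p k))) =
      7 / w * √(cliqueMass c p k) := by
    intro k
    have h1 := (Real.sqrt_pos.2 (hmass k)).ne'
    nth_rewrite 1 [← Real.sq_sqrt (hmass k).le]
    field_simp
  rw [hsplit, ← Finset.sum_fiberwise Finset.univ c]
  set S := ∑ k ∈ Finset.univ.erase (c istar), √(cliqueMass c p k) with hS
  have hS0 : 0 ≤ S := Finset.sum_nonneg fun _ _ => Real.sqrt_nonneg _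
  by_cases hP : 3 / 4 ≤ cliqueMass c p (c istar)
  · have hstar : ∑ j ∈ cliqueSet c (c istar), p j * stabilityBound c istar w p j =
        cliqueMass c p (c istar) * (7 * (1 - p istar / cliqueMass c p (c istar)) /
          (w * √(cliqueMass c p (c istar))) + S / w) := by
      rw [cliqueMass, Finset.sum_mul]
      refine Finset.sum_congr rfl fun j hj => ?_
      have hj' : c j = c istar := by simpa using hj
      rw [stabilityBound, if_pos ⟨hP, hj'⟩, hS, Finset.sum_div]
      rfl
    have hne : ∀ k ∈ Finset.univ.erase (c istar),
        ∑ j ∈ cliqueSet c k, p j * stabilityBound c istar w p j = 7 / w * √(cliqueMass c p k) := by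
      intro k hk
      rw [← hother]
      nth_rewrite 1 [cliqueMass]
      rw [Finset.sum_mul]
      refine Finset.sum_congr rfl fun j hj => ?_
      have hj' : c j = k := by simpa using hj
      rw [stabilityBound, if_neg (fun h => Finset.ne_of_mem_erase hk (hj'.symm.trans h.2)), hj']
    rw [← Finset.add_sum_erase _ _ (Finset.mem_univ (c istar)), hstar, Finset.sum_congr rfl hne,
      ← Finset.mul_sum, ← hS]
    have hP1 : cliqueMass c p (c istar) ≤ 1 := cliqueMass_le_one hp _
    have hres := residualMass_self (c := c) (p := p) istar
    have hres0 := residualMass_nonneg (c := c) hp istar (c istar)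
    have hle := residualMass_le (c := c) hp istar (c istar)
    have hPpos := hmass (c istar)
    have h1 : cliqueMass c p (c istar) * (7 * (1 - p istar / cliqueMass c p (c istar)) /
        (w * √(cliqueMass c p (c istar)))) ≤ 7 / w * √(residualMass c istar p (c istar)) := by
      have e1 : cliqueMass c p (c istar) * (7 * (1 - p istar / cliqueMass c p (c istar)) /
          (w * √(cliqueMass c p (c istar)))) =
          7 / w * (residualMass c istar p (c istar) / √(cliqueMass c p (c istar))) := by
        have := (Real.sqrt_pos.2 hPpos).ne'
        rw [hres]
        field_simp
      rw [e1]
      refine mul_le_mul_of_nonneg_left ?_ (by positivity)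
      rw [div_le_iff₀ (Real.sqrt_pos.2 hPpos)]
      calc residualMass c istar p (c istar)
          = √(residualMass c istar p (c istar)) * √(residualMass c istar p (c istar)) :=
            (Real.mul_self_sqrt hres0).symm
        _ ≤ _ := mul_le_mul_of_nonneg_left (Real.sqrt_le_sqrt hle) (Real.sqrt_nonneg _)
    have h2 : cliqueMass c p (c istar) * (S / w) ≤ 1 / w * S := by
      rw [one_div_mul_eq_div]
      exact mul_le_of_le_one_left (by positivity) hP1
    have h3 : 35 / w * (√(residualMass c istar p (c istar)) + S) =
        7 / w * √(residualMass c istar p (c istar)) + 1 / w * S + 7 / w * S +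
          (28 / w * √(residualMass c istar p (c istar)) + 27 / w * S) := by ring
    have h4 : 0 ≤ 28 / w * √(residualMass c istar p (c istar)) + 27 / w * S := by positivity
    rw [mul_add, h3]
    linarith
  · have hall : ∀ k ∈ Finset.univ,
        ∑ j ∈ cliqueSet c k, p j * stabilityBound c istar w p j = 7 / w * √(cliqueMass c p k) := by
      intro k _
      rw [← hother]
      nth_rewrite 1 [cliqueMass]
      rw [Finset.sum_mul]
      refine Finset.sum_congr rfl fun j hj => ?_
      have hj' : c j = k := by simpa using hj
      rw [stabilityBound, if_neg (fun h => hP h.1), hj']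
    rw [Finset.sum_congr rfl hall, ← Finset.mul_sum,
      ← Finset.add_sum_erase _ _ (Finset.mem_univ (c istar)), ← hS]
    -- the other cliques have total mass at least `1 / 4`
    have h1 : 1 / 4 ≤ S := by
      have e1 := sum_cliqueMass c p
      rw [hp.1.2, ← Finset.add_sum_erase _ _ (Finset.mem_univ (c istar))] at e1
      have e2 : ∑ k ∈ Finset.univ.erase (c istar), cliqueMass c p k ≤ S :=
        Finset.sum_le_sum fun k _ => by
          refine Real.le_sqrt_of_sq_le ?_
          nlinarith [hmass k, cliqueMass_le_one (c := c) hp k]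
      linarith [not_le.1 hP]
    have h2 : √(cliqueMass c p (c istar)) ≤ 1 := Real.sqrt_le_one.2 (cliqueMass_le_one hp _)
    have h3 : 7 / w * (√(cliqueMass c p (c istar)) + S) ≤ 7 / w * (5 * S) :=
      mul_le_mul_of_nonneg_left (by linarith) (by positivity)
    have h4 : 0 ≤ 35 / w * √(residualMass c istar p (c istar)) := by positivity
    have h5 : 35 / w * (√(residualMass c istar p (c istar)) + S) =
      35 / w * √(residualMass c istar p (c istar)) + 7 / w * (5 * S) := by ring
    rw [h5]
    linarith

end Simplex

/-! ### The pathwise regret bound -/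

section Regret

variable {N K T : ℕ} {c : Fin N → Fin K} {p q : Fin N → ℝ} {γ L α : ℝ}

/-- The penalty term is controlled by the masses without the arm `istar`. -/
lemma neg_tsallisShannon_sub_le (hc : Function.Surjective c) (hγ : 0 < γ)
    (hL : -L ≤ Real.log γ) (hL12 : 12 ≤ L) (hα : 2 * (L ^ 2 + 1) ≤ α)
    (hp : p ∈ truncatedSimplex N γ) (istar : Fin N) :
    -tsallisShannon α c p - α ≤ (α + L) * ∑ k, √(residualMass c istar p k) := by
  have hV := cliqueSet_nonempty hc
  have hmass := cliqueMass_pos hc hγ hp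
  have hp0 : ∀ k, ∀ i ∈ cliqueSet c k, 0 < p i := fun _ i _ => pos_of_mem_truncatedSimplex hγ hp i
  have hlog := neg_le_log_condProb (c := c) hγ hL hp
  have hα0 : 0 ≤ α := le_trans (by positivity) hα
  have h1 : -tsallisShannon α c p = ∑ k, √(cliqueMass c p k) *
      (α + entropyOn (cliqueSet c k) (condProb (cliqueSet c k) p)) := by
    rw [tsallisShannon_eq_sum, ← Finset.sum_neg_distrib]
    refine Finset.sum_congr rfl fun k _ => ?_
    rw [cliquePotential_eq (hV k) (hp0 k), cliqueMass]
    ring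
  have hother : ∀ k ∈ Finset.univ.erase (c istar), √(cliqueMass c p k) *
      (α + entropyOn (cliqueSet c k) (condProb (cliqueSet c k) p)) ≤
        (α + L) * √(residualMass c istar p k) := by
    intro k hk
    rw [residualMass_of_ne (Finset.ne_of_mem_erase hk), mul_comm]
    have := entropyOn_le (isPosProb_condProb (hV k) (hp0 k)) (hlog k)
    exact mul_le_mul_of_nonneg_right (by linarith) (Real.sqrt_nonneg _)
  have hself : √(cliqueMass c p (c istar)) *
      (α + entropyOn (cliqueSet c (c istar)) (condProb (cliqueSet c (c istar)) p)) ≤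
        α + (α + L) * √(residualMass c istar p (c istar)) := by
    have hE := entropyOn_le_of_mem (isPosProb_condProb (hV (c istar)) (hp0 _)) (hlog _)
      (j := istar) (by simp)
    have hP := hmass (c istar)
    have hP1 : √(cliqueMass c p (c istar)) ≤ 1 := Real.sqrt_le_one.2 (cliqueMass_le_one hp _)
    have hs := Real.sqrt_pos.2 hP
    have hle := Real.sqrt_le_sqrt (residualMass_le (c := c) hp istar (c istar))
    have hres : √(cliqueMass c p (c istar)) * (1 - condProb (cliqueSet c (c istar)) p istar) ≤
        √(residualMass c istar p (c istar)) := by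
      have e1 : √(cliqueMass c p (c istar)) * (1 - condProb (cliqueSet c (c istar)) p istar) =
          residualMass c istar p (c istar) / √(cliqueMass c p (c istar)) := by
        rw [residualMass_self, condProb]
        change √(cliqueMass c p (c istar)) * (1 - p istar / cliqueMass c p (c istar)) = _
        nth_rewrite 2 [← Real.sq_sqrt hP.le]
        nth_rewrite 3 [← Real.sq_sqrt hP.le]
        field_simp
      rw [e1, div_le_iff₀ hs]
      nth_rewrite 1 [← Real.mul_self_sqrt (residualMass_nonneg hp istar (c istar))]
      exact mul_le_mul_of_nonneg_left hle (Real.sqrt_nonneg _)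
    have e2 := mul_le_mul_of_nonneg_left hE hs.le
    have e3 := mul_le_mul_of_nonneg_left hres (by linarith : 0 ≤ L + 1)
    have e4 : (L + 1) * √(residualMass c istar p (c istar)) ≤
        (α + L) * √(residualMass c istar p (c istar)) :=
      mul_le_mul_of_nonneg_right (by nlinarith) (Real.sqrt_nonneg _)
    nlinarith
  rw [h1, Finset.mul_sum, ← Finset.add_sum_erase _ _ (Finset.mem_univ (c istar)),
    ← Finset.add_sum_erase _ _ (Finset.mem_univ (c istar))]
  have := Finset.sum_le_sum hother
  linarith

/-- The point mass at the arm `j`, moved into the truncated simplex by mixing it with the uniform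
distribution with weight `1 / T`. -/
noncomputable def comparator (N T : ℕ) (j i : Fin N) : ℝ :=
  (1 - 1 / (T : ℝ)) * (if i = j then 1 else 0) + 1 / ((N : ℝ) * T)

lemma comparator_mem (hT : 1 ≤ T) (j : Fin N) :
    comparator N T j ∈ truncatedSimplex N (1 / ((N : ℝ) * T)) := by
  have hT' : (1 : ℝ) ≤ T := by exact_mod_cast hT
  have hN : (N : ℝ) ≠ 0 := by have := j.pos; positivity
  have h1 : 0 ≤ 1 - 1 / (T : ℝ) := sub_nonneg.2 (by rw [div_le_iff₀ (by linarith)]; linarith)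
  have h2 : ∀ i, 1 / ((N : ℝ) * T) ≤ comparator N T j i := fun i => by
    unfold comparator
    have : (0 : ℝ) ≤ (1 - 1 / (T : ℝ)) * (if i = j then 1 else 0) :=
      mul_nonneg h1 (by split_ifs <;> norm_num)
    linarith
  refine ⟨⟨fun i => le_trans (by positivity) (h2 i), ?_⟩, h2⟩
  unfold comparator
  rw [Finset.sum_add_distrib, ← Finset.mul_sum, Finset.sum_ite_eq' Finset.univ j,
    if_pos (Finset.mem_univ j), Finset.sum_const, Finset.card_univ, Fintype.card_fin, nsmul_eq_mul]
  field_simp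
  ring

/-- The entropic part of the potential is nonpositive, so that only the clique of `j` matters. -/
lemma tsallisShannon_comparator_le (hc : Function.Surjective c) (hT : 1 ≤ T) (hα : 0 ≤ α)
    (j : Fin N) : tsallisShannon α c (comparator N T j) ≤ -α * (1 - 1 / (T : ℝ)) := by
  have hN := j.pos
  have hγ : 0 < 1 / ((N : ℝ) * T) := by positivity
  have hu := comparator_mem hT j
  have hle : ∀ k, cliquePotential α (cliqueSet c k) (comparator N T j) ≤
      -α * √(cliqueMass c (comparator N T j) k) := fun k => by
    have hp0 : ∀ i ∈ cliqueSet c k, 0 < comparator N T j i :=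
      fun i _ => pos_of_mem_truncatedSimplex hγ hu i
    rw [cliquePotential_eq (cliqueSet_nonempty hc k) hp0]
    have h1 := entropyOn_nonneg (isPosProb_condProb (cliqueSet_nonempty hc k) hp0)
    have h2 : 0 ≤ √(cliqueMass c (comparator N T j) k) := Real.sqrt_nonneg _
    rw [cliqueMass] at h2 ⊢
    nlinarith [mul_nonneg h2 h1]
  rw [tsallisShannon_eq_sum]
  refine (Finset.sum_le_sum fun k _ => hle k).trans ?_
  rw [← Finset.mul_sum, neg_mul, neg_mul, neg_le_neg_iff]
  refine mul_le_mul_of_nonneg_left ?_ hα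
  have h3 : √(cliqueMass c (comparator N T j) (c j)) ≤
      ∑ k, √(cliqueMass c (comparator N T j) k) :=
    Finset.single_le_sum (fun k _ => Real.sqrt_nonneg _) (Finset.mem_univ _)
  refine le_trans ?_ h3
  have h4 := le_cliqueMass (c := c) hu j
  have h5 : 1 - 1 / (T : ℝ) ≤ comparator N T j j := by
    unfold comparator
    rw [if_pos rfl]
    linarith
  have h6 := cliqueMass_le_one (c := c) hu (c j)
  have h7 : 0 ≤ cliqueMass c (comparator N T j) (c j) := (hu.1.1 j).trans h4
  refine (h5.trans h4).trans (Real.le_sqrt_of_sq_le ?_)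
  nlinarith

lemma cliqueLogBarrier_le (hγ : 0 < γ) (hL : -L ≤ Real.log γ)
    (hc : Function.Surjective c) (hp : p ∈ truncatedSimplex N γ) :
    cliqueLogBarrier 9 c p ≤ 9 * (K * L) := by
  have h : ∑ _k : Fin K, -L ≤ ∑ k, Real.log (cliqueMass c p k) := Finset.sum_le_sum fun k _ => by
    obtain ⟨i, rfl⟩ := hc k
    exact hL.trans (Real.log_le_log hγ ((hp.2 i).trans (le_cliqueMass hp i)))
  rw [Finset.sum_const, Finset.card_univ, Fintype.card_fin, nsmul_eq_mul] at h
  rw [cliqueLogBarrier]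
  linarith

lemma cliqueLogBarrier_nonneg (hp : p ∈ truncatedSimplex N γ) : 0 ≤ cliqueLogBarrier 9 c p := by
  have h : ∑ k, Real.log (cliqueMass c p k) ≤ 0 := Finset.sum_nonpos fun k _ =>
    Real.log_nonpos (Finset.sum_nonneg fun i _ => hp.1.1 i) (cliqueMass_le_one hp k)
  rw [cliqueLogBarrier]
  linarith

lemma sum_filter_val_lt_succ {M : Type*} [AddCommMonoid M] (f : Fin T → M) {n : ℕ} (hn : n < T) :
    ∑ t with t.val < n + 1, f t = ∑ t with t.val < n, f t + f ⟨n, hn⟩ := by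
  classical
  have h : (Finset.univ.filter fun t : Fin T => t.val < n + 1) =
      insert ⟨n, hn⟩ (Finset.univ.filter fun t : Fin T => t.val < n) := by
    ext t
    simp only [Finset.mem_filter_univ, Finset.mem_insert, Fin.ext_iff]
    omega
  rw [h, Finset.sum_insert (by simp), add_comm]

lemma sum_filter_val_lt_self {M : Type*} [AddCommMonoid M] (f : Fin T → M) :
    ∑ t with t.val < T, f t = ∑ t, f t := by
  rw [Finset.filter_true_of_mem fun t _ => t.isLt]

/-- Regret of follow the regularized leader.  The inequality is proved by induction on the number
of rounds for all `q` at once; the induction hypothesis is applied to the next prediction, at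
which the new objective is minimal. -/
lemma ftrl_regret_le (hc : Function.Surjective c) (hγ : 0 < γ)
    {x p : Fin T → Fin N → ℝ} {b : Fin T → ℝ}
    (hp : ∀ t, p t ∈ truncatedSimplex N γ)
    (hmin : ∀ t : Fin T, IsMinOn (ftrlObjective α √((t : ℝ) + 1) c
      (fun i => ∑ s with s.val < t.val, x s i)) (truncatedSimplex N γ) (p t))
    (hb : ∀ t : Fin T, ∀ q ∈ truncatedSimplex N γ, ∑ i, x t i * (p t i - q i) -
      √((t : ℝ) + 1) * ∑ k, potentialDivergence α (cliqueSet c k) q (p t) ≤ b t)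
    (hq : q ∈ truncatedSimplex N γ) :
    ∑ t, (∑ i, x t i * p t i - b t + (√((t : ℝ) + 1) - √(t : ℝ)) * tsallisShannon α c (p t)) ≤
      ∑ i, (∑ t, x t i) * q i + (√T * tsallisShannon α c q + cliqueLogBarrier 9 c q) := by
  have key : ∀ n ≤ T, ∀ q ∈ truncatedSimplex N γ,
      ∑ t with t.val < n, (∑ i, x t i * p t i - b t +
          (√((t : ℝ) + 1) - √(t : ℝ)) * tsallisShannon α c (p t)) ≤
        ftrlObjective α √(n : ℝ) c (fun i => ∑ t with t.val < n, x t i) q := by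
    intro n
    induction n with
    | zero =>
      intro _ q hq
      simp [ftrlObjective, cliqueLogBarrier_nonneg hq]
    | succ n ih =>
      intro hn q hq
      have hnT : n < T := hn
      have h1 := ih hnT.le (p ⟨n, hnT⟩) (hp _)
      have h2 := ftrlObjective_ge hc hγ (hp ⟨n, hnT⟩) (hmin ⟨n, hnT⟩) hq
      have h3 := hb ⟨n, hnT⟩ q hq
      have h4 : ∑ i, x ⟨n, hnT⟩ i * (p ⟨n, hnT⟩ i - q i) =
          ∑ i, x ⟨n, hnT⟩ i * p ⟨n, hnT⟩ i - ∑ i, x ⟨n, hnT⟩ i * q i := by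
        rw [← Finset.sum_sub_distrib]
        exact Finset.sum_congr rfl fun i _ => by ring
      rw [h4] at h3
      rw [sum_filter_val_lt_succ _ hnT]
      simp only [ftrlObjective, sum_filter_val_lt_succ _ hnT, add_mul, Finset.sum_add_distrib,
        Nat.cast_add, Nat.cast_one] at h1 h2 h3 ⊢
      linarith
  have h := key T le_rfl q hq
  rw [sum_filter_val_lt_self] at h
  simpa only [ftrlObjective, sum_filter_val_lt_self] using h

lemma sum_sqrt_succ_sub_sqrt (T : ℕ) : ∑ t : Fin T, (√((t : ℝ) + 1) - √(t : ℝ)) = √(T : ℝ) := by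
  rw [Fin.sum_univ_eq_sum_range (fun n : ℕ => √((n : ℝ) + 1) - √(n : ℝ))]
  have h := Finset.sum_range_sub (fun n : ℕ => √(n : ℝ)) T
  push_cast at h
  rw [h, Real.sqrt_zero, sub_zero]

lemma sqrt_succ_sub_sqrt_mem {x : ℝ} (hx : 0 ≤ x) :
    √(x + 1) - √x ∈ Set.Icc 0 (1 / √(x + 1)) := by
  have h1 := Real.sqrt_le_sqrt (by linarith : x ≤ x + 1)
  have h2 : 0 < √(x + 1) := Real.sqrt_pos.2 (by linarith)
  refine ⟨by linarith, ?_⟩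
  rw [le_div_iff₀ h2]
  nlinarith [Real.mul_self_sqrt hx, Real.mul_self_sqrt (by linarith : 0 ≤ x + 1), Real.sqrt_nonneg x]

/-- The regret of the predictions against the comparator of the arm `j`, along one sequence of
loss estimates. -/
lemma ftrl_regret_comparator_le (hc : Function.Surjective c) (hT : 1 ≤ T)
    (hL : L = Real.log ((N : ℝ) * T)) (hL12 : 12 ≤ L) (hα : α = 2 * (L ^ 2 + 1))
    {x p : Fin T → Fin N → ℝ} {b : Fin T → ℝ} (istar j : Fin N)
    (hp : ∀ t, p t ∈ truncatedSimplex N (1 / ((N : ℝ) * T)))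
    (hmin : ∀ t : Fin T, IsMinOn (ftrlObjective α √((t : ℝ) + 1) c
      (fun i => ∑ s with s.val < t.val, x s i)) (truncatedSimplex N (1 / ((N : ℝ) * T))) (p t))
    (hb : ∀ t : Fin T, ∀ q ∈ truncatedSimplex N (1 / ((N : ℝ) * T)),
      ∑ i, x t i * (p t i - q i) -
        √((t : ℝ) + 1) * ∑ k, potentialDivergence α (cliqueSet c k) q (p t) ≤ b t) :
    ∑ t, ∑ i, x t i * (p t i - comparator N T j i) ≤
      ∑ t, (b t + (α + L) / √((t : ℝ) + 1) * ∑ k, √(residualMass c istar (p t) k)) +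
        (α + 9 * (K * L)) := by
  have hN := j.pos
  have hT' : (1 : ℝ) ≤ T := by exact_mod_cast hT
  have hγ : 0 < 1 / ((N : ℝ) * T) := by positivity
  have hLγ : -L ≤ Real.log (1 / ((N : ℝ) * T)) := by rw [one_div, Real.log_inv, hL]
  have hα0 : 0 ≤ α := by rw [hα]; positivity
  have hu := comparator_mem hT j
  have h1 := ftrl_regret_le hc hγ hp hmin hb hu
  have h2 := cliqueLogBarrier_le (c := c) hγ hLγ hc hu
  have h3 : √(T : ℝ) * tsallisShannon α c (comparator N T j) ≤ -α * √(T : ℝ) + α := by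
    have e1 := mul_le_mul_of_nonneg_left (tsallisShannon_comparator_le hc hT hα0 j)
      (Real.sqrt_nonneg (T : ℝ))
    have e2 : √(T : ℝ) * (1 / (T : ℝ)) ≤ 1 := by
      rw [mul_one_div, div_le_one (by linarith)]
      exact Real.sqrt_le_iff.2 ⟨by linarith, by nlinarith⟩
    nlinarith [mul_le_mul_of_nonneg_left e2 hα0]
  have h4 : ∀ t : Fin T, (√((t : ℝ) + 1) - √(t : ℝ)) * (-tsallisShannon α c (p t) - α) ≤
      (α + L) / √((t : ℝ) + 1) * ∑ k, √(residualMass c istar (p t) k) := by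
    intro t
    obtain ⟨e1, e2⟩ := sqrt_succ_sub_sqrt_mem (Nat.cast_nonneg (α := ℝ) t.val)
    have e3 := neg_tsallisShannon_sub_le hc hγ hLγ hL12 hα.ge (hp t) istar
    have e4 : 0 ≤ (α + L) * ∑ k, √(residualMass c istar (p t) k) :=
      mul_nonneg (by linarith) (Finset.sum_nonneg fun _ _ => Real.sqrt_nonneg _)
    calc _ ≤ (√((t : ℝ) + 1) - √(t : ℝ)) * ((α + L) * ∑ k, √(residualMass c istar (p t) k)) :=
          mul_le_mul_of_nonneg_left e3 e1
      _ ≤ 1 / √((t : ℝ) + 1) * ((α + L) * ∑ k, √(residualMass c istar (p t) k)) :=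
          mul_le_mul_of_nonneg_right e2 e4
      _ = _ := by ring
  have h5 := Finset.sum_le_sum fun t (_ : t ∈ Finset.univ) => h4 t
  have h6 : ∑ t : Fin T, (√((t : ℝ) + 1) - √(t : ℝ)) * (-tsallisShannon α c (p t) - α) =
      -∑ t : Fin T, (√((t : ℝ) + 1) - √(t : ℝ)) * tsallisShannon α c (p t) - α * √(T : ℝ) := by
    rw [← sum_sqrt_succ_sub_sqrt T, Finset.mul_sum, ← Finset.sum_neg_distrib,
      ← Finset.sum_sub_distrib]
    exact Finset.sum_congr rfl fun t _ => by ring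
  have h7 : ∑ t, ∑ i, x t i * (p t i - comparator N T j i) =
      ∑ t, ∑ i, x t i * p t i - ∑ i, (∑ t, x t i) * comparator N T j i := by
    simp only [mul_sub, Finset.sum_sub_distrib, Finset.sum_mul]
    congr 1
    exact Finset.sum_comm
  rw [h6] at h5
  simp only [Finset.sum_add_distrib, Finset.sum_sub_distrib] at h1 h5 h7 ⊢
  linarith

end Regret

/-! ### Measurability of the predictions -/

section Argmin

variable {N K : ℕ} {c : Fin N → Fin K} {γ L α w : ℝ}

/-- Inside a clique the feedback reveals all losses. -/
lemma lossEstimate_graphFeedback {G : SimpleGraph (Fin N)} (hc : IsCliquePartition G c)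
    (p : Fin N → ℝ) (j : Fin N) (l : Fin N → ℝ) (i : Fin N) :
    lossEstimate c p j (graphFeedback G j l) i = weightedLoss c p j l i := by
  unfold lossEstimate weightedLoss
  split_ifs with h
  · have h1 : i = j ∨ G.Adj j i := by
      by_cases hij : i = j
      · exact Or.inl hij
      · exact Or.inr (hc.2 (c j) rfl h (Ne.symm hij))
    rw [graphFeedback, if_pos h1, Option.getD_some]
  · rfl

lemma isFTRLPrediction_iff {T : ℕ} {G : SimpleGraph (Fin N)} (hc : IsCliquePartition G c)
    {l p : Fin T → Fin N → ℝ} {I : Fin T → Fin N} :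
    IsFTRLPrediction G c l I p ↔ ∀ t : Fin T,
      p t ∈ truncatedSimplex N (1 / ((N : ℝ) * T)) ∧
      IsMinOn (ftrlObjective (2 * (Real.log ((N : ℝ) * T) ^ 2 + 1)) √((t : ℝ) + 1) c
        (fun i => ∑ s with s.val < t.val, weightedLoss c (p s) (I s) (l s) i))
        (truncatedSimplex N (1 / ((N : ℝ) * T))) (p t) := by
  have h1 : ∀ t : Fin T, Finset.Iio t = Finset.univ.filter fun s : Fin T => s.val < t.val :=
    fun t => by ext s; simp
  unfold IsFTRLPrediction ftrlObjective
  simp only [cumulativeEstimate, lossEstimate_graphFeedback hc, regularizer, stepSize, one_div,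
    inv_inv, h1]

lemma isCompact_truncatedSimplex : IsCompact (truncatedSimplex N γ) := by
  have h : truncatedSimplex N γ = stdSimplex ℝ (Fin N) ∩ ⋂ i, {p | γ ≤ p i} := by
    ext p; simp [truncatedSimplex]
  rw [h]
  exact (isCompact_stdSimplex ℝ (Fin N)).inter_right
    (isClosed_iInter fun i => isClosed_le continuous_const (continuous_apply i))

lemma continuous_cliqueMass (c : Fin N → Fin K) (k : Fin K) :
    Continuous fun p : Fin N → ℝ => cliqueMass c p k :=
  continuous_finsetSum _ fun i _ => continuous_apply i

lemma continuous_ftrlObjective (hc : Function.Surjective c) (hγ : 0 < γ) :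
    Continuous fun z : (Fin N → ℝ) × truncatedSimplex N γ =>
      ftrlObjective α w c z.1 (z.2 : Fin N → ℝ) := by
  have hq : ∀ i, Continuous fun z : (Fin N → ℝ) × truncatedSimplex N γ => (z.2 : Fin N → ℝ) i :=
    fun i => (continuous_apply i).comp (continuous_subtype_val.comp continuous_snd)
  have hm : ∀ k, Continuous fun z : (Fin N → ℝ) × truncatedSimplex N γ =>
      cliqueMass c (z.2 : Fin N → ℝ) k :=
    fun k => (continuous_cliqueMass c k).comp (continuous_subtype_val.comp continuous_snd)
  have hm0 : ∀ k (z : (Fin N → ℝ) × truncatedSimplex N γ), cliqueMass c (z.2 : Fin N → ℝ) k ≠ 0 :=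
    fun k z => (cliqueMass_pos hc hγ z.2.2 k).ne'
  have hs0 : ∀ k (z : (Fin N → ℝ) × truncatedSimplex N γ),
      √(cliqueMass c (z.2 : Fin N → ℝ) k) ≠ 0 :=
    fun k z => (Real.sqrt_pos.2 (cliqueMass_pos hc hγ z.2.2 k)).ne'
  have hq0 : ∀ i (z : (Fin N → ℝ) × truncatedSimplex N γ), (z.2 : Fin N → ℝ) i ≠ 0 :=
    fun i z => (pos_of_mem_truncatedSimplex hγ z.2.2 i).ne'
  unfold ftrlObjective tsallisShannon cliqueLogBarrier
  refine Continuous.add (continuous_finsetSum _ fun i _ =>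
    ((continuous_apply i).comp continuous_fst).mul (hq i)) (Continuous.add (continuous_const.mul
      (Continuous.add (continuous_const.mul (continuous_finsetSum _ fun k _ => (hm k).sqrt))
        (continuous_finsetSum _ fun k _ => Continuous.mul
          (continuous_const.div (hm k).sqrt (hs0 k)) (continuous_finsetSum _ fun i _ =>
            (hq i).mul (((hq i).div (hm k) (hm0 k)).log
              fun z => div_ne_zero (hq0 i z) (hm0 k z))))))
      (continuous_const.mul (continuous_finsetSum _ fun k _ => (hm k).log (hm0 k))))

/-- The minimizer depends continuously on the cumulative losses: its graph is closed, because the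
objective is continuous, and the truncated simplex is compact. -/
lemma exists_continuous_minimizer (hc : Function.Surjective c) (hγ : 0 < γ)
    (hL : -L ≤ Real.log γ) (hL12 : 12 ≤ L) (hα : 2 * (L ^ 2 + 1) ≤ α) (hw : 0 < w)
    (hne : (truncatedSimplex N γ).Nonempty) :
    ∃ A : (Fin N → ℝ) → (Fin N → ℝ), Continuous A ∧ ∀ x, ∀ p ∈ truncatedSimplex N γ,
      IsMinOn (ftrlObjective α w c x) (truncatedSimplex N γ) p → p = A x := by
  have hcomp : CompactSpace (truncatedSimplex N γ) :=
    isCompact_iff_compactSpace.1 isCompact_truncatedSimplex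
  have hcont := continuous_ftrlObjective (α := α) (w := w) hc hγ
  have hex : ∀ x, ∃ a : truncatedSimplex N γ, ∀ q : truncatedSimplex N γ,
      ftrlObjective α w c x a ≤ ftrlObjective α w c x q := fun x => by
    have h1 : Continuous fun q : truncatedSimplex N γ => ftrlObjective α w c x q :=
      hcont.comp (Continuous.prodMk_right x)
    obtain ⟨a, -, ha⟩ := isCompact_univ.exists_isMinOn
      (@Set.univ_nonempty _ hne.to_subtype) h1.continuousOn
    exact ⟨a, fun q => ha (Set.mem_univ q)⟩
  choose A hA using hex
  have huniq : ∀ x, ∀ p ∈ truncatedSimplex N γ,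
      IsMinOn (ftrlObjective α w c x) (truncatedSimplex N γ) p → p = A x := fun x p hp hmin =>
    ftrlObjective_minimizer_unique hc hγ hL hL12 hα hw (A x).2 (fun q hq => hA x ⟨q, hq⟩) hp hmin
  refine ⟨fun x => A x, continuous_subtype_val.comp ?_, huniq⟩
  rw [continuous_iff_isClosed]
  intro s hs
  have hgraph : IsClosed {z : (Fin N → ℝ) × truncatedSimplex N γ |
      ∀ q : truncatedSimplex N γ, ftrlObjective α w c z.1 z.2 ≤ ftrlObjective α w c z.1 q} := by
    have h2 := isClosed_iInter fun q : truncatedSimplex N γ =>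
      isClosed_le hcont (hcont.comp (continuous_fst.prodMk (continuous_const (y := q))))
    convert h2 using 1
    ext z
    simp
  have hpre : A ⁻¹' s = Prod.fst '' ({z : (Fin N → ℝ) × truncatedSimplex N γ |
      ∀ q : truncatedSimplex N γ, ftrlObjective α w c z.1 z.2 ≤ ftrlObjective α w c z.1 q} ∩
        Prod.snd ⁻¹' s) := by
    ext x
    constructor
    · intro hx
      exact ⟨(x, A x), ⟨hA x, hx⟩, rfl⟩
    · rintro ⟨⟨x', a⟩, ⟨h3, h4⟩, rfl⟩
      have h5 : a = A x' := Subtype.ext (huniq x' a a.2 fun q hq => h3 ⟨q, hq⟩)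
      exact h5 ▸ h4
  rw [hpre]
  exact isClosedMap_fst_of_compactSpace _ (hgraph.inter (hs.preimage continuous_snd))

end Argmin

section Measurability

variable {Ω : Type*} {N K T : ℕ} {c : Fin N → Fin K} {m : MeasurableSpace Ω}

lemma measurable_cliqueMass {p : Ω → Fin N → ℝ} (hp : Measurable p) (k : Fin K) :
    Measurable fun ω => cliqueMass c (p ω) k :=
  (continuous_cliqueMass c k).measurable.comp hp

lemma measurable_weightedLoss {p l : Ω → Fin N → ℝ} {J : Ω → Fin N} (hp : Measurable p)
    (hl : Measurable l) (hJ : Measurable J) (i : Fin N) :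
    Measurable fun ω => weightedLoss c (p ω) (J ω) (l ω) i := by
  unfold weightedLoss
  refine Measurable.ite ?_ (((measurable_pi_apply i).comp hl).div (measurable_cliqueMass hp _))
    measurable_const
  exact hJ (Set.toFinite {j | c i = c j}).measurableSet

lemma pastInteraction_mono {l : Fin T → Ω → Fin N → ℝ} {I : Fin T → Ω → Fin N} {s t : Fin T}
    (h : s ≤ t) : pastInteraction l I s ≤ pastInteraction l I t :=
  iSup₂_le fun r hr => le_iSup₂_of_le r (hr.trans_le h) le_rfl

lemma comap_le_pastInteraction {l : Fin T → Ω → Fin N → ℝ} {I : Fin T → Ω → Fin N} {s t : Fin T}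
    (h : s < t) : MeasurableSpace.comap (I s) inferInstance ⊔
      MeasurableSpace.comap (l s) inferInstance ≤ pastInteraction l I t :=
  le_iSup₂_of_le (f := fun (s : Fin T) (_ : s < t) =>
    MeasurableSpace.comap (I s) inferInstance ⊔ MeasurableSpace.comap (l s) inferInstance)
    s h le_rfl

/-- The prediction of a round is a function of the interaction in the earlier rounds. -/
lemma measurable_prediction {G : SimpleGraph (Fin N)} (hc : IsCliquePartition G c) (hT : 1 ≤ T)
    (hL12 : 12 ≤ Real.log ((N : ℝ) * T)) (j : Fin N) {l : Fin T → Ω → Fin N → ℝ}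
    {I : Fin T → Ω → Fin N} {p : Fin T → Ω → Fin N → ℝ}
    (hp : ∀ ω, IsFTRLPrediction G c (fun t => l t ω) (fun t => I t ω) (fun t => p t ω))
    (t : Fin T) : Measurable[pastInteraction l I t] (p t) := by
  have hN := j.pos
  have hγ : 0 < 1 / ((N : ℝ) * T) := by positivity
  have hLγ : -Real.log ((N : ℝ) * T) ≤ Real.log (1 / ((N : ℝ) * T)) := by
    rw [one_div, Real.log_inv]
  induction t using WellFoundedLT.induction with
  | ind t ih =>
    obtain ⟨A, hA, hAp⟩ := exists_continuous_minimizer (w := √((t : ℝ) + 1)) hc.1 hγ hLγ hL12 le_rfl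
      (Real.sqrt_pos.2 (by positivity)) ⟨_, comparator_mem hT j⟩
    have h1 : p t = fun ω => A fun i =>
        ∑ s with s.val < t.val, weightedLoss c (p s ω) (I s ω) (l s ω) i := by
      funext ω
      have h2 := (isFTRLPrediction_iff hc).1 (hp ω) t
      exact hAp _ _ h2.1 h2.2
    rw [h1]
    refine hA.measurable.comp (@measurable_pi_lambda _ _ _ (pastInteraction l I t) _ _ fun i =>
      Finset.measurable_fun_sum _ fun s hs => ?_)
    have hst : s < t := (Finset.mem_filter.1 hs).2
    have h3 := comap_le_pastInteraction (l := l) (I := I) hst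
    exact measurable_weightedLoss ((ih s hst).mono (pastInteraction_mono hst.le) le_rfl)
      ((comap_measurable (l s)).mono (le_sup_right.trans h3) le_rfl)
      ((comap_measurable (I s)).mono (le_sup_left.trans h3) le_rfl) i

lemma measurable_residualMass {p : Ω → Fin N → ℝ} (hp : Measurable p) (istar : Fin N)
    (k : Fin K) : Measurable fun ω => residualMass c istar (p ω) k :=
  Finset.measurable_fun_sum _ fun i _ => (measurable_pi_apply i).comp hp

lemma measurable_stabilityBound {p : Ω → Fin N → ℝ} (hp : Measurable p) (istar j : Fin N)
    (w : ℝ) : Measurable fun ω => stabilityBound c istar w (p ω) j := by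
  have hm := fun k => measurable_cliqueMass (c := c) hp k
  unfold stabilityBound
  refine Measurable.ite ?_ ?_ ?_
  · exact (measurableSet_le measurable_const (hm _)).inter (MeasurableSet.const _)
  · exact ((measurable_const.mul (measurable_const.sub (((measurable_pi_apply istar).comp hp).div
      (hm _)))).div (measurable_const.mul (hm _).sqrt)).add
        (Finset.measurable_fun_sum _ fun k _ => (hm k).sqrt.div_const _)
  · exact measurable_const.div (measurable_const.mul (hm _).sqrt)

end Measurability

/-! ### Expectations over the arms and over the stochastic losses -/

section Expectation

variable {Ω : Type*} {F mΩ : MeasurableSpace Ω} {P : Measure Ω} [IsProbabilityMeasure P]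

lemma integrable_of_abs_le {f : Ω → ℝ} {B : ℝ} (hf : Measurable f) (hB : ∀ ω, |f ω| ≤ B) :
    Integrable f P :=
  Integrable.of_bound hf.aestronglyMeasurable B (ae_of_all _ hB)

/-- Averaging over an arm with known conditional probabilities. -/
lemma integral_comp_arm {N : ℕ} (hF : F ≤ mΩ) {J : Ω → Fin N}
    (hJ : Measurable J) {p : Ω → Fin N → ℝ} (hp : Measurable p) (hp1 : ∀ ω i, |p ω i| ≤ 1)
    (hsamp : ∀ i, P[Set.indicator {ω | J ω = i} (fun _ => (1 : ℝ)) | F] =ᵐ[P] fun ω => p ω i)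
    {Y : Fin N → Ω → ℝ} {B : ℝ} (hY : ∀ j, Measurable[F] (Y j)) (hB : ∀ j ω, |Y j ω| ≤ B) :
    ∫ ω, Y (J ω) ω ∂P = ∫ ω, ∑ j, p ω j * Y j ω ∂P := by
  have hset : ∀ j, MeasurableSet {ω | J ω = j} := fun j => hJ (measurableSet_singleton j)
  have hind : ∀ j, Measurable (Set.indicator {ω | J ω = j} (fun _ => (1 : ℝ))) := fun j =>
    measurable_const.indicator (hset j)
  have hind1 : ∀ j ω, |Set.indicator {ω | J ω = j} (fun _ => (1 : ℝ)) ω| ≤ 1 := fun j ω => by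
    by_cases h : ω ∈ {ω | J ω = j}
    · rw [Set.indicator_of_mem h, abs_one]
    · rw [Set.indicator_of_notMem h, abs_zero]; exact zero_le_one
  have hYm : ∀ j, Measurable (Y j) := fun j => (hY j).mono hF le_rfl
  have hbd : ∀ {x y : ℝ}, |x| ≤ B → |y| ≤ 1 → |x * y| ≤ B := fun {x y} hx hy => by
    rw [abs_mul]
    exact (mul_le_of_le_one_right (abs_nonneg _) hy).trans hx
  have hint : ∀ j, Integrable (Y j * Set.indicator {ω | J ω = j} (fun _ => (1 : ℝ))) P := fun j =>
    integrable_of_abs_le ((hYm j).mul (hind j)) fun ω => hbd (hB j ω) (hind1 j ω)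
  have hint' : ∀ j, Integrable (fun ω => p ω j * Y j ω) P := fun j =>
    integrable_of_abs_le (B := B) (((measurable_pi_apply j).comp hp).mul (hYm j)) fun ω => by
      rw [mul_comm]; exact hbd (hB j ω) (hp1 ω j)
  have hsum : ∀ ω, Y (J ω) ω =
      ∑ j, (Y j * Set.indicator {ω | J ω = j} (fun _ => (1 : ℝ))) ω := fun ω => by
    rw [Finset.sum_eq_single (J ω)]
    · simp
    · intro j _ hj
      simp [Ne.symm hj]
    · simp
  simp only [hsum]
  rw [integral_finsetSum _ fun j _ => hint j, integral_finsetSum _ fun j _ => hint' j]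
  refine Finset.sum_congr rfl fun j _ => ?_
  rw [← integral_condExp hF]
  refine integral_congr_ae ?_
  have h1 := condExp_mul_of_stronglyMeasurable_left (hY j).stronglyMeasurable (hint j)
    (integrable_of_abs_le (P := P) (hind j) (hind1 j))
  filter_upwards [h1, hsamp j] with ω h2 h3
  rw [h2, Pi.mul_apply, h3, mul_comm]

variable {N K : ℕ} {c : Fin N → Fin K} {γ : ℝ} {J : Ω → Fin N} {p l : Ω → Fin N → ℝ}

lemma abs_le_one_of_mem_truncatedSimplex {q : Fin N → ℝ} (hq : q ∈ truncatedSimplex N γ)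
    (i : Fin N) : |q i| ≤ 1 := by
  rw [abs_of_nonneg (hq.1.1 i), ← hq.1.2]
  exact Finset.single_le_sum (fun j _ => hq.1.1 j) (Finset.mem_univ i)

lemma abs_weightedLoss_le (hγ : 0 < γ) {q : Fin N → ℝ} (hq : q ∈ truncatedSimplex N γ)
    {x : Fin N → ℝ} (hx : ∀ i, x i ∈ Set.Icc (0 : ℝ) 1) (j i : Fin N) :
    |weightedLoss c q j x i| ≤ 1 / γ := by
  have h1 : γ ≤ cliqueMass c q (c i) := (hq.2 i).trans (le_cliqueMass hq i)
  unfold weightedLoss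
  split_ifs with h
  · rw [abs_of_nonneg (div_nonneg (hx i).1 (hγ.le.trans h1))]
    exact div_le_div₀ zero_le_one (hx i).2 hγ h1
  · rw [abs_zero]; positivity

lemma abs_sum_weightedLoss_mul_sub_le (hγ : 0 < γ) {q u : Fin N → ℝ}
    (hq : q ∈ truncatedSimplex N γ) (hu : u ∈ truncatedSimplex N γ)
    {x : Fin N → ℝ} (hx : ∀ i, x i ∈ Set.Icc (0 : ℝ) 1) (j : Fin N) :
    |∑ i, weightedLoss c q j x i * (q i - u i)| ≤ ∑ _i : Fin N, 1 / γ * 2 := by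
  refine (Finset.abs_sum_le_sum_abs _ _).trans (Finset.sum_le_sum fun i _ => ?_)
  rw [abs_mul]
  refine mul_le_mul (abs_weightedLoss_le hγ hq hx j i) ?_ (abs_nonneg _) (by positivity)
  have := abs_sub (q i) (u i)
  linarith [abs_le_one_of_mem_truncatedSimplex hq i, abs_le_one_of_mem_truncatedSimplex hu i]

/-- The loss estimator is unbiased. -/
lemma sum_mul_weightedLoss (hc : Function.Surjective c) (hγ : 0 < γ) {q : Fin N → ℝ}
    (hq : q ∈ truncatedSimplex N γ) (x : Fin N → ℝ) (i : Fin N) :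
    ∑ j, q j * weightedLoss c q j x i = x i := by
  have h0 := (cliqueMass_pos hc hγ hq (c i)).ne'
  have h1 : ∀ j, q j * weightedLoss c q j x i =
      (if c j = c i then q j else 0) * (x i / cliqueMass c q (c i)) := fun j => by
    unfold weightedLoss
    by_cases h : c i = c j
    · rw [if_pos h, if_pos h.symm]
    · rw [if_neg h, if_neg (Ne.symm h), mul_zero, zero_mul]
  simp only [h1]
  rw [← Finset.sum_mul, ← Finset.sum_filter]
  change cliqueMass c q (c i) * _ = _
  field_simp

lemma integral_weightedLoss (hc : Function.Surjective c) (hγ : 0 < γ) (hF : F ≤ mΩ)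
    (hJ : Measurable J) (hp : Measurable[F] p) (hl : Measurable[F] l)
    (hpS : ∀ ω, p ω ∈ truncatedSimplex N γ) (hl1 : ∀ ω i, l ω i ∈ Set.Icc (0 : ℝ) 1)
    (hsamp : ∀ i, P[Set.indicator {ω | J ω = i} (fun _ => (1 : ℝ)) | F] =ᵐ[P] fun ω => p ω i)
    {u : Fin N → ℝ} (hu : u ∈ truncatedSimplex N γ) :
    ∫ ω, ∑ i, weightedLoss c (p ω) (J ω) (l ω) i * (p ω i - u i) ∂P =
      ∫ ω, ∑ i, l ω i * (p ω i - u i) ∂P := by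
  have h := integral_comp_arm hF hJ (hp.mono hF le_rfl)
    (fun ω i => abs_le_one_of_mem_truncatedSimplex (hpS ω) i) hsamp
    (Y := fun j ω => ∑ i, weightedLoss c (p ω) j (l ω) i * (p ω i - u i))
    (fun j => Finset.measurable_fun_sum _ fun i _ =>
      (measurable_weightedLoss hp hl measurable_const i).mul
        (((measurable_pi_apply i).comp hp).sub_const _))
    (fun j ω => abs_sum_weightedLoss_mul_sub_le hγ (hpS ω) hu (hl1 ω) j)
  refine h.trans (integral_congr_ae (ae_of_all _ fun ω => ?_))
  simp only [Finset.mul_sum]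
  rw [Finset.sum_comm]
  refine Finset.sum_congr rfl fun i _ => ?_
  rw [← sum_mul_weightedLoss hc hγ (hpS ω) (l ω) i, Finset.sum_mul]
  exact Finset.sum_congr rfl fun j _ => by ring

lemma sqrt_residualMass_le_one {q : Fin N → ℝ} (hq : q ∈ truncatedSimplex N γ) (istar : Fin N)
    (k : Fin K) : √(residualMass c istar q k) ≤ 1 :=
  Real.sqrt_le_one.2 ((residualMass_le hq istar k).trans (cliqueMass_le_one hq k))

lemma integrable_sum_sqrt_residualMass (hp : Measurable p)
    (hpS : ∀ ω, p ω ∈ truncatedSimplex N γ) (istar : Fin N) :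
    Integrable (fun ω => ∑ k, √(residualMass c istar (p ω) k)) P :=
  integrable_finsetSum _ fun k _ => integrable_of_abs_le (B := 1)
    (measurable_residualMass hp istar k).sqrt fun ω => by
      rw [abs_of_nonneg (Real.sqrt_nonneg _)]
      exact sqrt_residualMass_le_one (hpS ω) istar k

/-- A crude bound, for integrability: a single term of the average over the arms. -/
lemma abs_stabilityBound_le (hc : Function.Surjective c) (hγ : 0 < γ) {w : ℝ} (hw : 0 < w)
    {q : Fin N → ℝ} (hq : q ∈ truncatedSimplex N γ) (istar j : Fin N) :
    |stabilityBound c istar w q j| ≤ 35 / w * K / γ := by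
  have h0 := fun j => stabilityBound_nonneg (c := c) hw hq istar j
  rw [abs_of_nonneg (h0 j), le_div_iff₀ hγ]
  have h1 := sum_mul_stabilityBound_le hc hγ hw hq istar
  have h2 : q j * stabilityBound c istar w q j ≤ ∑ j, q j * stabilityBound c istar w q j :=
    Finset.single_le_sum (f := fun j => q j * stabilityBound c istar w q j)
      (fun j _ => mul_nonneg (hq.1.1 j) (h0 j)) (Finset.mem_univ j)
  have h3 : ∑ k, √(residualMass c istar q k) ≤ ∑ _k : Fin K, (1 : ℝ) :=
    Finset.sum_le_sum fun k _ => sqrt_residualMass_le_one hq istar k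
  rw [Finset.sum_const, Finset.card_univ, Fintype.card_fin, nsmul_eq_mul, mul_one] at h3
  have h4 := mul_le_mul_of_nonneg_left h3 (by positivity : 0 ≤ 35 / w)
  have h5 := mul_le_mul_of_nonneg_right (hq.2 j) (h0 j)
  linarith

lemma integral_stabilityBound_le (hc : Function.Surjective c) (hγ : 0 < γ) {w : ℝ} (hw : 0 < w)
    (hF : F ≤ mΩ) (hJ : Measurable J) (hp : Measurable[F] p)
    (hpS : ∀ ω, p ω ∈ truncatedSimplex N γ)
    (hsamp : ∀ i, P[Set.indicator {ω | J ω = i} (fun _ => (1 : ℝ)) | F] =ᵐ[P] fun ω => p ω i)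
    (istar : Fin N) :
    ∫ ω, stabilityBound c istar w (p ω) (J ω) ∂P ≤
      35 / w * ∫ ω, ∑ k, √(residualMass c istar (p ω) k) ∂P := by
  have hp' : Measurable p := hp.mono hF le_rfl
  have hb := fun j ω => abs_stabilityBound_le (w := w) hc hγ hw (hpS ω) istar j
  have h := integral_comp_arm hF hJ hp'
    (fun ω i => abs_le_one_of_mem_truncatedSimplex (hpS ω) i) hsamp
    (Y := fun j ω => stabilityBound c istar w (p ω) j)
    (fun j => measurable_stabilityBound hp istar j w) hb
  rw [h, ← integral_const_mul]
  refine integral_mono ?_ ((integrable_sum_sqrt_residualMass hp' hpS istar).const_mul _)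
    fun ω => sum_mul_stabilityBound_le hc hγ hw (hpS ω) istar
  refine integrable_finsetSum _ fun j _ => integrable_of_abs_le (B := 1 * (35 / w * K / γ))
    (((measurable_pi_apply j).comp hp').mul (measurable_stabilityBound hp' istar j w))
      fun ω => ?_
  rw [abs_mul]
  exact mul_le_mul (abs_le_one_of_mem_truncatedSimplex (hpS ω) j) (hb j ω) (abs_nonneg _)
    zero_le_one

lemma measurable_stabilityBound_arm (hp : Measurable p) (hJ : Measurable J) (istar : Fin N)
    (w : ℝ) : Measurable fun ω => stabilityBound c istar w (p ω) (J ω) := by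
  have h : Measurable fun z : Ω × Fin N => stabilityBound c istar w (p z.1) z.2 :=
    measurable_from_prod_countable_left fun j => measurable_stabilityBound hp istar j w
  exact h.comp (measurable_id.prodMk hJ)

lemma integral_loss_arm (hF : F ≤ mΩ) (hJ : Measurable J) (hp : Measurable[F] p)
    (hl : Measurable[F] l) (hpS : ∀ ω, p ω ∈ truncatedSimplex N γ)
    (hl1 : ∀ ω i, l ω i ∈ Set.Icc (0 : ℝ) 1)
    (hsamp : ∀ i, P[Set.indicator {ω | J ω = i} (fun _ => (1 : ℝ)) | F] =ᵐ[P] fun ω => p ω i) :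
    ∫ ω, l ω (J ω) ∂P = ∫ ω, ∑ i, p ω i * l ω i ∂P :=
  integral_comp_arm hF hJ (hp.mono hF le_rfl)
    (fun ω i => abs_le_one_of_mem_truncatedSimplex (hpS ω) i) hsamp (Y := fun i ω => l ω i) (B := 1)
    (fun i => (measurable_pi_apply i).comp hl)
    (fun i ω => by rw [abs_of_nonneg (hl1 ω i).1]; exact (hl1 ω i).2)

end Expectation

section Environment

variable {Ω : Type*} [MeasurableSpace Ω] {P : Measure Ω}
  {N K T : ℕ} {c : Fin N → Fin K} {G : SimpleGraph (Fin N)} {ν : Measure (Fin N → ℝ)}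
  {lt l : Fin T → Ω → Fin N → ℝ} {I : Fin T → Ω → Fin N} {p : Fin T → Ω → Fin N → ℝ}

lemma IsCorruptedStochastic.pastInteraction_le (henv : IsCorruptedStochastic P ν lt l I)
    (t : Fin T) : pastInteraction l I t ≤ ‹MeasurableSpace Ω› :=
  iSup₂_le fun s _ => sup_le (henv.measurable_arm s).comap_le (henv.measurable_loss s).comap_le

lemma IsCorruptedStochastic.sup_le (henv : IsCorruptedStochastic P ν lt l I)
    (t : Fin T) : pastInteraction l I t ⊔ MeasurableSpace.comap (l t) inferInstance ≤
      ‹MeasurableSpace Ω› :=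
  _root_.sup_le (henv.pastInteraction_le t) (henv.measurable_loss t).comap_le

lemma IsCorruptedStochastic.integral_stoch (henv : IsCorruptedStochastic P ν lt l I)
    (t : Fin T) (i : Fin N) : ∫ ω, lt t ω i ∂P = meanLoss ν i := by
  rw [meanLoss, ← henv.law t, integral_map (henv.measurable_stoch t).aemeasurable
    (measurable_pi_apply i).aestronglyMeasurable]

/-- The stochastic loss of a round is independent of the prediction of that round. -/
lemma IsCorruptedStochastic.integral_mul_stoch [IsProbabilityMeasure P]
    (henv : IsCorruptedStochastic P ν lt l I)
    (t : Fin T) (i : Fin N) {f : Ω → ℝ} (hf : Measurable[pastInteraction l I t] f) :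
    ∫ ω, f ω * lt t ω i ∂P = (∫ ω, f ω ∂P) * meanLoss ν i := by
  have hind : IndepFun (lt t) f P := by
    rw [IndepFun_iff_Indep]
    exact indep_of_indep_of_le_right (henv.indep_past t) hf.comap_le
  have h := IndepFun.integral_fun_mul_eq_mul_integral
    ((hind.comp (measurable_pi_apply i) measurable_id).symm)
    (hf.mono (henv.pastInteraction_le t) le_rfl).aestronglyMeasurable
    ((measurable_pi_apply i).comp (henv.measurable_stoch t)).aestronglyMeasurable
  rw [← henv.integral_stoch t i]
  exact h

end Environment

/-! ### Upper and lower bounds for the expected regret -/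

section Bounds

variable {Ω : Type*} [MeasurableSpace Ω] {P : Measure Ω}
  {N K T : ℕ} {c : Fin N → Fin K} {G : SimpleGraph (Fin N)} {ν : Measure (Fin N → ℝ)}
  {lt l : Fin T → Ω → Fin N → ℝ} {I : Fin T → Ω → Fin N} {p : Fin T → Ω → Fin N → ℝ} {L : ℝ}

lemma IsCorruptedStochastic.measurable_loss_arm (henv : IsCorruptedStochastic P ν lt l I)
    (t : Fin T) : Measurable fun ω => l t ω (I t ω) := by
  have h : Measurable fun z : Ω × Fin N => l t z.1 z.2 :=
    measurable_from_prod_countable_left fun j => (measurable_pi_apply j).comp (henv.measurable_loss t)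
  exact h.comp (measurable_id.prodMk (henv.measurable_arm t))

lemma IsCorruptedStochastic.integrable_loss_arm [IsProbabilityMeasure P]
    (henv : IsCorruptedStochastic P ν lt l I)
    (t : Fin T) : Integrable (fun ω => l t ω (I t ω)) P :=
  integrable_of_abs_le (B := 1) (henv.measurable_loss_arm t) fun ω => by
    rw [abs_of_nonneg (henv.loss_mem t ω _).1]; exact (henv.loss_mem t ω _).2

lemma IsCorruptedStochastic.integrable_loss [IsProbabilityMeasure P]
    (henv : IsCorruptedStochastic P ν lt l I)
    (t : Fin T) (i : Fin N) : Integrable (fun ω => l t ω i) P :=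
  integrable_of_abs_le (B := 1) ((measurable_pi_apply i).comp (henv.measurable_loss t)) fun ω => by
    rw [abs_of_nonneg (henv.loss_mem t ω _).1]; exact (henv.loss_mem t ω _).2

lemma IsCorruptedStochastic.integrable_stoch [IsProbabilityMeasure P]
    (henv : IsCorruptedStochastic P ν lt l I)
    (t : Fin T) (i : Fin N) : Integrable (fun ω => lt t ω i) P :=
  integrable_of_abs_le (B := 1) ((measurable_pi_apply i).comp (henv.measurable_stoch t)) fun ω => by
    rw [abs_of_nonneg (henv.stoch_mem t ω _).1]; exact (henv.stoch_mem t ω _).2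

lemma IsCorruptedStochastic.norm_sub_le (henv : IsCorruptedStochastic P ν lt l I)
    (t : Fin T) (ω : Ω) : ‖l t ω - lt t ω‖ ≤ 1 := by
  refine (pi_norm_le_iff_of_nonneg zero_le_one).2 fun i => ?_
  rw [Pi.sub_apply, Real.norm_eq_abs, abs_le]
  constructor <;>
    linarith [(henv.loss_mem t ω i).1, (henv.loss_mem t ω i).2, (henv.stoch_mem t ω i).1,
      (henv.stoch_mem t ω i).2]

lemma IsCorruptedStochastic.integrable_norm_sub [IsProbabilityMeasure P]
    (henv : IsCorruptedStochastic P ν lt l I)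
    (t : Fin T) : Integrable (fun ω => ‖l t ω - lt t ω‖) P :=
  integrable_of_abs_le (B := 1) ((henv.measurable_loss t).sub (henv.measurable_stoch t)).norm
    fun ω => by rw [abs_of_nonneg (norm_nonneg _)]; exact henv.norm_sub_le t ω

lemma integrable_mul_of_abs_le_one {f : Ω → ℝ} {g : Ω → ℝ} (hf : Measurable f)
    (hf1 : ∀ ω, |f ω| ≤ 1) (hg : Integrable g P) : Integrable (fun ω => f ω * g ω) P :=
  hg.bdd_mul hf.aestronglyMeasurable (ae_of_all _ hf1)

/-- The expected regret against any arm `j`, bounded through the masses without `istar`. -/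
lemma regret_le_sum_residualMass [IsProbabilityMeasure P] (hc : IsCliquePartition G c) (hT : 1 ≤ T)
    (hL : L = Real.log ((N : ℝ) * T)) (hL12 : 12 ≤ L)
    (henv : IsCorruptedStochastic P ν lt l I)
    (hp : ∀ ω, IsFTRLPrediction G c (fun t => l t ω) (fun t => I t ω) (fun t => p t ω))
    (hI : IsSampledFrom P l I p) (istar j : Fin N) :
    (∫ ω, ∑ t, l t ω (I t ω) ∂P) - ∫ ω, ∑ t, l t ω j ∂P ≤
      3 * L ^ 2 * ∑ t : Fin T, 1 / √((t : ℝ) + 1) * ∫ ω, ∑ k, √(residualMass c istar (p t ω) k) ∂P +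
        (9 * (K * L) + 2 * L ^ 2 + 3) := by
  have hN := j.pos
  have hT' : (1 : ℝ) ≤ T := by exact_mod_cast hT
  have hγ : 0 < 1 / ((N : ℝ) * T) := by positivity
  have hLγ : -L ≤ Real.log (1 / ((N : ℝ) * T)) := by rw [one_div, Real.log_inv, hL]
  obtain ⟨α, hα⟩ : ∃ α, α = 2 * (L ^ 2 + 1) := ⟨_, rfl⟩
  have hpred := fun ω => (isFTRLPrediction_iff hc).1 (hp ω)
  have hpS : ∀ t ω, p t ω ∈ truncatedSimplex N (1 / ((N : ℝ) * T)) := fun t ω => (hpred ω t).1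
  have hu := comparator_mem hT j
  set u := comparator N T j with hudef
  have hF := henv.sup_le
  have hpF : ∀ t, Measurable[pastInteraction l I t ⊔ MeasurableSpace.comap (l t) inferInstance]
      (p t) := fun t => (measurable_prediction hc hT (hL ▸ hL12) j hp t).mono le_sup_left le_rfl
  have hlF : ∀ t, Measurable[pastInteraction l I t ⊔ MeasurableSpace.comap (l t) inferInstance]
      (l t) := fun t => (comap_measurable (l t)).mono le_sup_right le_rfl
  have hpm : ∀ t, Measurable (p t) := fun t => (hpF t).mono (hF t) le_rfl
  have hw : ∀ t : Fin T, 1 ≤ √((t : ℝ) + 1) := fun t => Real.one_le_sqrt.2 (by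
    have : (0 : ℝ) ≤ t := Nat.cast_nonneg _
    linarith)
  have hw0 : ∀ t : Fin T, 0 < √((t : ℝ) + 1) := fun t => zero_lt_one.trans_le (hw t)
  -- the pathwise bound
  have hpath : ∀ ω, ∑ t, ∑ i, weightedLoss c (p t ω) (I t ω) (l t ω) i * (p t ω i - u i) ≤
      ∑ t : Fin T, (stabilityBound c istar √((t : ℝ) + 1) (p t ω) (I t ω) +
        (α + L) / √((t : ℝ) + 1) * ∑ k, √(residualMass c istar (p t ω) k)) +
          (α + 9 * (K * L)) := fun ω =>
    ftrl_regret_comparator_le hc.1 hT hL hL12 hα istar j (fun t => hpS t ω)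
      (fun t => by rw [hα, hL]; exact (hpred ω t).2)
      fun t q hq => sum_mul_sub_le_stabilityBound hc.1 hγ hLγ hL12 hα.ge (hw t) (hpS t ω) hq
        (henv.loss_mem t ω) istar (I t ω)
  have hint1 : ∀ t, Integrable (fun ω => ∑ i, weightedLoss c (p t ω) (I t ω) (l t ω) i *
      (p t ω i - u i)) P := fun t =>
    integrable_of_abs_le (Finset.measurable_fun_sum _ fun i _ =>
      (measurable_weightedLoss (hpm t) (henv.measurable_loss t) (henv.measurable_arm t) i).mul
        (((measurable_pi_apply i).comp (hpm t)).sub_const _))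
      fun ω => abs_sum_weightedLoss_mul_sub_le hγ (hpS t ω) hu (henv.loss_mem t ω) (I t ω)
  have hint2 : ∀ t : Fin T, Integrable (fun ω =>
      stabilityBound c istar √((t : ℝ) + 1) (p t ω) (I t ω)) P := fun t =>
    integrable_of_abs_le (measurable_stabilityBound_arm (hpm t) (henv.measurable_arm t) istar _)
      fun ω => abs_stabilityBound_le hc.1 hγ (hw0 t) (hpS t ω) istar _
  have hint3 : ∀ t, Integrable (fun ω => ∑ k, √(residualMass c istar (p t ω) k)) P := fun t =>
    integrable_sum_sqrt_residualMass (hpm t) (hpS t) istar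
  have hint4 : ∀ t : Fin T, Integrable (fun ω =>
      stabilityBound c istar √((t : ℝ) + 1) (p t ω) (I t ω) +
        (α + L) / √((t : ℝ) + 1) * ∑ k, √(residualMass c istar (p t ω) k)) P := fun t =>
    (hint2 t).add ((hint3 t).const_mul _)
  have hexp := integral_mono (integrable_finsetSum _ fun t _ => hint1 t)
    ((integrable_finsetSum _ fun t _ => hint4 t).add (integrable_const (α + 9 * (K * L)))) hpath
  simp only [Pi.add_apply] at hexp
  rw [integral_add (integrable_finsetSum _ fun t _ => hint4 t) (integrable_const _),
    integral_finsetSum _ fun t _ => hint1 t, integral_finsetSum _ fun t _ => hint4 t,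
    integral_const, probReal_univ, one_smul] at hexp
  have hround : ∀ t : Fin T, ∫ ω, (stabilityBound c istar √((t : ℝ) + 1) (p t ω) (I t ω) +
        (α + L) / √((t : ℝ) + 1) * ∑ k, √(residualMass c istar (p t ω) k)) ∂P ≤
      3 * L ^ 2 * (1 / √((t : ℝ) + 1) * ∫ ω, ∑ k, √(residualMass c istar (p t ω) k) ∂P) := by
    intro t
    rw [integral_add (hint2 t) ((hint3 t).const_mul _), integral_const_mul]
    have h1 := integral_stabilityBound_le (w := √((t : ℝ) + 1)) hc.1 hγ (hw0 t) (hF t)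
      (henv.measurable_arm t) (hpF t) (hpS t) (hI t) istar
    have h2 : 0 ≤ ∫ ω, ∑ k, √(residualMass c istar (p t ω) k) ∂P :=
      integral_nonneg fun ω => Finset.sum_nonneg fun _ _ => Real.sqrt_nonneg _
    generalize ∫ ω, ∑ k, √(residualMass c istar (p t ω) k) ∂P = E at h1 h2 ⊢
    have h3 : 35 + (α + L) ≤ 3 * L ^ 2 := by rw [hα]; nlinarith
    have h4 : 0 ≤ 1 / √((t : ℝ) + 1) * E := mul_nonneg (one_div_pos.2 (hw0 t)).le h2
    have h5 := mul_le_mul_of_nonneg_right h3 h4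
    have h6 : (35 + (α + L)) * (1 / √((t : ℝ) + 1) * E) =
      35 / √((t : ℝ) + 1) * E + (α + L) / √((t : ℝ) + 1) * E := by ring
    linarith
  -- the cost of moving the arm `j` into the truncated simplex is at most `1 / T` per round
  have hregret : ∀ t : Fin T, ∫ ω, l t ω (I t ω) ∂P - ∫ ω, l t ω j ∂P - 1 / (T : ℝ) ≤
      ∫ ω, ∑ i, weightedLoss c (p t ω) (I t ω) (l t ω) i * (p t ω i - u i) ∂P := by
    intro t
    have hintp : Integrable (fun ω => ∑ i, p t ω i * l t ω i) P := integrable_finsetSum _ fun i _ =>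
      integrable_mul_of_abs_le_one ((measurable_pi_apply i).comp (hpm t))
        (fun ω => abs_le_one_of_mem_truncatedSimplex (hpS t ω) i) (henv.integrable_loss t i)
    rw [integral_weightedLoss hc.1 hγ (hF t) (henv.measurable_arm t) (hpF t) (hlF t) (hpS t)
      (henv.loss_mem t) (hI t) hu, integral_loss_arm (hF t) (henv.measurable_arm t) (hpF t) (hlF t)
      (hpS t) (henv.loss_mem t) (hI t), ← integral_sub hintp (henv.integrable_loss t j)]
    have hintd : Integrable (fun ω => ∑ i, p t ω i * l t ω i - l t ω j) P :=
      hintp.sub (henv.integrable_loss t j)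
    have h0 : ∫ ω, (∑ i, p t ω i * l t ω i - l t ω j) ∂P - 1 / (T : ℝ) =
        ∫ ω, (∑ i, p t ω i * l t ω i - l t ω j - 1 / (T : ℝ)) ∂P := by
      rw [integral_sub hintd (integrable_const _), integral_const,
        probReal_univ, one_smul]
    rw [h0]
    refine integral_mono (hintd.sub (integrable_const _))
      (integrable_finsetSum _ fun i _ => ?_) fun ω => ?_
    · have h1 : (fun ω => l t ω i * (p t ω i - u i)) =
          fun ω => p t ω i * l t ω i - l t ω i * u i := by
        funext ω; ring
      rw [h1]
      exact (integrable_mul_of_abs_le_one ((measurable_pi_apply i).comp (hpm t))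
        (fun ω => abs_le_one_of_mem_truncatedSimplex (hpS t ω) i) (henv.integrable_loss t i)).sub
          ((henv.integrable_loss t i).mul_const _)
    · have h2 : ∑ i, l t ω i * (p t ω i - u i) =
          ∑ i, p t ω i * l t ω i - ((1 - 1 / (T : ℝ)) * l t ω j +
            (∑ i, l t ω i) * (1 / ((N : ℝ) * T))) := by
        have h3 : l t ω j = ∑ i, l t ω i * (if i = j then 1 else 0) := by simp
        rw [h3, Finset.mul_sum, Finset.sum_mul, ← Finset.sum_add_distrib, ← Finset.sum_sub_distrib]
        refine Finset.sum_congr rfl fun i _ => ?_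
        rw [hudef, comparator]
        ring
      simp only [h2]
      have h4 : ∑ i, l t ω i ≤ ∑ _i : Fin N, (1 : ℝ) :=
        Finset.sum_le_sum fun i _ => (henv.loss_mem t ω i).2
      rw [Finset.sum_const, Finset.card_univ, Fintype.card_fin, nsmul_eq_mul, mul_one] at h4
      have h5 := mul_le_mul_of_nonneg_right h4 hγ.le
      have hN' : (N : ℝ) ≠ 0 := by positivity
      have h6 : (N : ℝ) * (1 / ((N : ℝ) * T)) = 1 / T := by field_simp
      have h7 : 0 ≤ 1 / (T : ℝ) * l t ω j := mul_nonneg (by positivity) (henv.loss_mem t ω j).1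
      linarith
  have hsum := Finset.sum_le_sum fun t (_ : t ∈ Finset.univ) => hregret t
  have hsum2 := Finset.sum_le_sum fun t (_ : t ∈ Finset.univ) => hround t
  rw [Finset.sum_sub_distrib, Finset.sum_sub_distrib, Finset.sum_const, Finset.card_univ,
    Fintype.card_fin, nsmul_eq_mul, mul_one_div, div_self (by linarith)] at hsum
  rw [integral_finsetSum _ fun t _ => henv.integrable_loss_arm t,
    integral_finsetSum _ fun t _ => henv.integrable_loss t j, Finset.mul_sum]
  rw [hα] at hexp hsum2
  linarith

lemma cliqueGap_le {istar i : Fin N} (hi : i ≠ istar) :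
    cliqueGap ν c istar (c i) ≤ meanLoss ν i - meanLoss ν istar :=
  csInf_le ((Set.toFinite _).image _).bddBelow ⟨i, ⟨rfl, hi⟩, rfl⟩

/-- The regret against `istar` is at least the expected gap of the played arms, up to twice the
corruption. -/
lemma sum_cliqueGap_mul_le_regret [IsProbabilityMeasure P] (hc : IsCliquePartition G c) (hT : 1 ≤ T)
    (hL12 : 12 ≤ Real.log ((N : ℝ) * T)) (henv : IsCorruptedStochastic P ν lt l I)
    (hp : ∀ ω, IsFTRLPrediction G c (fun t => l t ω) (fun t => I t ω) (fun t => p t ω))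
    (hI : IsSampledFrom P l I p) (istar : Fin N) :
    ∑ t, ∑ k, cliqueGap ν c istar k * ∫ ω, residualMass c istar (p t ω) k ∂P -
        2 * corruptionLevel P lt l ≤
      (∫ ω, ∑ t, l t ω (I t ω) ∂P) - ∫ ω, ∑ t, l t ω istar ∂P := by
  have hpred := fun ω => (isFTRLPrediction_iff hc).1 (hp ω)
  have hpS : ∀ t ω, p t ω ∈ truncatedSimplex N (1 / ((N : ℝ) * T)) := fun t ω => (hpred ω t).1
  have hF := henv.sup_le
  have hpast := measurable_prediction hc hT hL12 istar hp
  have hpF : ∀ t, Measurable[pastInteraction l I t ⊔ MeasurableSpace.comap (l t) inferInstance]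
      (p t) := fun t => (hpast t).mono le_sup_left le_rfl
  have hlF : ∀ t, Measurable[pastInteraction l I t ⊔ MeasurableSpace.comap (l t) inferInstance]
      (l t) := fun t => (comap_measurable (l t)).mono le_sup_right le_rfl
  have hpi : ∀ t i, Measurable fun ω => p t ω i := fun t i =>
    (measurable_pi_apply i).comp ((hpF t).mono (hF t) le_rfl)
  have hp1 : ∀ t i ω, |p t ω i| ≤ 1 := fun t i ω =>
    abs_le_one_of_mem_truncatedSimplex (hpS t ω) i
  have hpint : ∀ t i, Integrable (fun ω => p t ω i) P := fun t i =>
    integrable_of_abs_le (hpi t i) (hp1 t i)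
  rw [corruptionLevel, integral_finsetSum _ fun t _ => henv.integrable_norm_sub t,
    integral_finsetSum _ fun t _ => henv.integrable_loss_arm t,
    integral_finsetSum _ fun t _ => henv.integrable_loss t istar, Finset.mul_sum,
    ← Finset.sum_sub_distrib, ← Finset.sum_sub_distrib]
  refine Finset.sum_le_sum fun t _ => ?_
  have hintp : Integrable (fun ω => ∑ i, p t ω i * l t ω i) P := integrable_finsetSum _ fun i _ =>
    integrable_mul_of_abs_le_one (hpi t i) (hp1 t i) (henv.integrable_loss t i)
  have hints : ∀ i, Integrable (fun ω => p t ω i * lt t ω i) P := fun i =>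
    integrable_mul_of_abs_le_one (hpi t i) (hp1 t i) (henv.integrable_stoch t i)
  have hints' : Integrable (fun ω => ∑ i, p t ω i * lt t ω i) P :=
    integrable_finsetSum _ fun i _ => hints i
  have hintd : Integrable (fun ω => ∑ i, p t ω i * lt t ω i - lt t ω istar) P :=
    hints'.sub (henv.integrable_stoch t istar)
  have hsum1 : ∑ i, ∫ ω, p t ω i ∂P = 1 := by
    rw [← integral_finsetSum _ fun i _ => hpint t i]
    simp only [fun ω => (hpS t ω).1.2]
    simp
  -- the stochastic losses are independent of the prediction
  have hstoch : ∫ ω, (∑ i, p t ω i * lt t ω i - lt t ω istar) ∂P =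
      ∑ i, (∫ ω, p t ω i ∂P) * (meanLoss ν i - meanLoss ν istar) := by
    rw [integral_sub hints' (henv.integrable_stoch t istar),
      integral_finsetSum _ fun i _ => hints i, henv.integral_stoch]
    simp only [mul_sub, Finset.sum_sub_distrib]
    rw [← Finset.sum_mul, hsum1, one_mul]
    congr 1
    exact Finset.sum_congr rfl fun i _ =>
      henv.integral_mul_stoch t i ((measurable_pi_apply i).comp (hpast t))
  have hcorr : ∫ ω, (∑ i, p t ω i * lt t ω i - lt t ω istar) ∂P -
      2 * ∫ ω, ‖l t ω - lt t ω‖ ∂P ≤ ∫ ω, (∑ i, p t ω i * l t ω i - l t ω istar) ∂P := by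
    rw [← integral_const_mul, ← integral_sub hintd ((henv.integrable_norm_sub t).const_mul 2)]
    refine integral_mono (hintd.sub ((henv.integrable_norm_sub t).const_mul 2))
      (hintp.sub (henv.integrable_loss t istar)) fun ω => ?_
    have h1 : ∀ i, |l t ω i - lt t ω i| ≤ ‖l t ω - lt t ω‖ := fun i =>
      norm_le_pi_norm (l t ω - lt t ω) i
    have h2 : ∑ i, p t ω i * lt t ω i ≤ ∑ i, p t ω i * l t ω i + ‖l t ω - lt t ω‖ := by
      have h3 : ∑ i, p t ω i * (lt t ω i - l t ω i) ≤ ∑ i, p t ω i * ‖l t ω - lt t ω‖ :=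
        Finset.sum_le_sum fun i _ => mul_le_mul_of_nonneg_left
          (by linarith [(abs_le.1 (h1 i)).1]) ((hpS t ω).1.1 i)
      rw [← Finset.sum_mul, (hpS t ω).1.2, one_mul] at h3
      simp only [mul_sub, Finset.sum_sub_distrib] at h3
      linarith
    have h4 := (abs_le.1 (h1 istar)).2
    simp only
    linarith
  have hgap : ∑ k, cliqueGap ν c istar k * ∫ ω, residualMass c istar (p t ω) k ∂P ≤
      ∑ i, (∫ ω, p t ω i ∂P) * (meanLoss ν i - meanLoss ν istar) := by
    rw [← Finset.sum_fiberwise Finset.univ c]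
    refine Finset.sum_le_sum fun k _ => ?_
    unfold residualMass
    rw [integral_finsetSum _ fun i _ => hpint t i, Finset.mul_sum, ← Finset.filter_filter,
      Finset.sum_filter]
    refine Finset.sum_le_sum fun i hi => ?_
    have hi' : c i = k := by simpa using hi
    split_ifs with h
    · rw [mul_comm, ← hi']
      exact mul_le_mul_of_nonneg_left (cliqueGap_le h)
        (integral_nonneg fun ω => (hpS t ω).1.1 i)
    · rw [not_not.1 h, sub_self, mul_zero]
  rw [integral_loss_arm (hF t) (henv.measurable_arm t) (hpF t) (hlF t) (hpS t) (henv.loss_mem t)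
    (hI t), ← integral_sub hintp (henv.integrable_loss t istar)]
  linarith

end Bounds

/-! ### Numerical consequences -/

lemma twelve_le_log_of_le {n : ℝ} (hn : 3 ^ 11 ≤ n) : 12 ≤ Real.log n := by
  rw [Real.le_log_iff_exp_le (by linarith [show (0 : ℝ) < 3 ^ 11 by norm_num])]
  refine le_trans ?_ hn
  have h1 : Real.exp 12 = Real.exp 1 ^ 12 := by rw [← Real.exp_nat_mul]; norm_num
  rw [h1]
  exact (pow_le_pow_left₀ (Real.exp_pos 1).le Real.exp_one_lt_d9.le 12).trans (by norm_num)

lemma sum_one_div_sqrt_le (T : ℕ) : ∑ t : Fin T, 1 / √((t : ℝ) + 1) ≤ 2 * √(T : ℝ) := by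
  rw [← sum_sqrt_succ_sub_sqrt, Finset.mul_sum]
  refine Finset.sum_le_sum fun t _ => ?_
  have ht : (0 : ℝ) ≤ t := Nat.cast_nonneg _
  have h1 : 0 < √((t : ℝ) + 1) := Real.sqrt_pos.2 (by linarith)
  rw [div_le_iff₀ h1]
  nlinarith [Real.mul_self_sqrt ht, Real.mul_self_sqrt (by linarith : 0 ≤ (t : ℝ) + 1),
    sq_nonneg (√((t : ℝ) + 1) - √(t : ℝ))]

lemma sum_one_div_le (T : ℕ) : ∑ t : Fin T, 1 / ((t : ℝ) + 1) ≤ 1 + Real.log T := by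
  refine le_of_eq_of_le ?_ (harmonic_le_one_add_log T)
  rw [Fin.sum_univ_eq_sum_range (fun n : ℕ => 1 / ((n : ℝ) + 1)), harmonic]
  push_cast
  exact Finset.sum_congr rfl fun n _ => one_div _

/-! ### The regret bounds -/

section Final

variable {N K T : ℕ} {c : Fin N → Fin K}

lemma sum_sqrt_residualMass_le {γ : ℝ} {p : Fin N → ℝ} (hp : p ∈ truncatedSimplex N γ)
    (istar : Fin N) : ∑ k, √(residualMass c istar p k) ≤ √(K : ℝ) := by
  refine Real.le_sqrt_of_sq_le ?_
  have h1 := sq_sum_le_card_mul_sum_sq (s := (Finset.univ : Finset (Fin K)))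
    (f := fun k => √(residualMass c istar p k))
  simp only [Real.sq_sqrt (residualMass_nonneg hp istar _), Finset.card_univ,
    Fintype.card_fin] at h1
  have h2 : ∑ k, residualMass c istar p k ≤ 1 := by
    rw [← hp.1.2, ← sum_cliqueMass c p]
    exact Finset.sum_le_sum fun k _ => residualMass_le hp istar k
  exact h1.trans (mul_le_of_le_one_right (Nat.cast_nonneg K) h2)

lemma cliqueGap_pos_of_mem {ν : Measure (Fin N → ℝ)} {istar i : Fin N}
    (hstar : ∀ i, i ≠ istar → meanLoss ν istar < meanLoss ν i) (hi : i ≠ istar) :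
    0 < cliqueGap ν c istar (c i) := by
  have hne : ((fun i => meanLoss ν i - meanLoss ν istar) ''
      {j | c j = c i ∧ j ≠ istar}).Nonempty := ⟨_, i, ⟨rfl, hi⟩, rfl⟩
  obtain ⟨j, hj, hje⟩ := hne.csInf_mem ((Set.toFinite _).image _)
  rw [cliqueGap, ← hje]
  exact sub_pos.2 (hstar j hj.2)

lemma residualMass_eq_zero {ν : Measure (Fin N → ℝ)} {istar : Fin N}
    (hstar : ∀ i, i ≠ istar → meanLoss ν istar < meanLoss ν i) {k : Fin K}
    (hk : ¬0 < cliqueGap ν c istar k) (p : Fin N → ℝ) : residualMass c istar p k = 0 := by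
  refine Finset.sum_eq_zero fun i hi => absurd ?_ hk
  obtain ⟨rfl, h2⟩ := (Finset.mem_filter.1 hi).2
  exact cliqueGap_pos_of_mem hstar h2

lemma gapSum_nonneg (hT : 1 ≤ T) (ν : Measure (Fin N → ℝ)) (istar : Fin N) :
    0 ≤ gapSum T ν c istar :=
  Finset.sum_nonneg fun k hk => div_nonneg (Real.log_nonneg (by exact_mod_cast hT))
    (Finset.mem_filter.1 hk).2.le

/-- The number of cliques is controlled by the sum of the inverse gaps, since all gaps are at most
one and at most one clique has gap zero. -/
lemma le_gapSum (hT : 2 ≤ T) {ν : Measure (Fin N → ℝ)} {istar i : Fin N}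
    (hc : Function.Surjective c) (hstar : ∀ i, i ≠ istar → meanLoss ν istar < meanLoss ν i)
    (hμ : ∀ i, meanLoss ν i ∈ Set.Icc (0 : ℝ) 1) (hi : i ≠ istar) :
    0.69 * (K : ℝ) ≤ 2 * gapSum T ν c istar ∧ 0.69 ≤ gapSum T ν c istar := by
  have hlog : 0.69 ≤ Real.log T := by
    have h1 : Real.log 2 ≤ Real.log T := Real.log_le_log (by norm_num) (by exact_mod_cast hT)
    have h2 := Real.log_two_gt_d9
    norm_num at h2 ⊢
    linarith
  set n := (Finset.univ.filter fun k => 0 < cliqueGap ν c istar k).card with hn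
  have hmem : ∀ j, j ≠ istar → c j ∈ Finset.univ.filter fun k => 0 < cliqueGap ν c istar k :=
    fun j hj => Finset.mem_filter.2 ⟨Finset.mem_univ _, cliqueGap_pos_of_mem hstar hj⟩
  have hn1 : 1 ≤ n := Finset.card_pos.2 ⟨_, hmem i hi⟩
  have hnK : K ≤ n + 1 := by
    have h1 : (Finset.univ : Finset (Fin K)) ⊆
        insert (c istar) (Finset.univ.filter fun k => 0 < cliqueGap ν c istar k) := by
      intro k _
      obtain ⟨j, rfl⟩ := hc k
      by_cases hj : j = istar
      · rw [hj]; exact Finset.mem_insert_self _ _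
      · exact Finset.mem_insert_of_mem (hmem j hj)
    have h2 := (Finset.card_le_card h1).trans (Finset.card_insert_le _ _)
    rwa [Finset.card_univ, Fintype.card_fin] at h2
  have hG : (n : ℝ) * 0.69 ≤ gapSum T ν c istar := by
    rw [hn, ← nsmul_eq_mul]
    refine Finset.card_nsmul_le_sum _ _ _ fun k hk => ?_
    have hk' := (Finset.mem_filter.1 hk).2
    have hk1 : cliqueGap ν c istar k ≤ 1 := by
      by_contra hcon
      have : ∃ j, c j = k ∧ j ≠ istar := by
        by_contra h
        have hempty : {j | c j = k ∧ j ≠ istar} = ∅ :=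
          Set.eq_empty_of_forall_notMem fun j hj => h ⟨j, hj⟩
        rw [cliqueGap, hempty, Set.image_empty, Real.sInf_empty] at hk'
        exact lt_irrefl _ hk'
      obtain ⟨j, rfl, hj⟩ := this
      have := cliqueGap_le (ν := ν) (c := c) hj
      linarith [(hμ j).2, (hμ istar).1]
    rw [le_div_iff₀ hk']
    nlinarith
  have hn1' : (1 : ℝ) ≤ n := by exact_mod_cast hn1
  have hnK' : (K : ℝ) ≤ n + 1 := by exact_mod_cast hnK
  constructor <;> norm_num at hG ⊢ <;> linarith

/-- The self-bounding argument: if the regret `R` is bounded above through the square roots of the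
residual masses and below through the residual masses, then `(1 + x) R - x R` gives a bound in
which the residual masses are optimized out, for every weight `x ∈ (0, 1]`. -/
lemma self_bounding {ι : Type*} {s : Finset ι} {Δ : ι → ℝ} (hΔ : ∀ k ∈ s, 0 < Δ k)
    {e m : Fin T → ι → ℝ} (hem : ∀ t, ∀ k ∈ s, ∀ z > 0, e t k ≤ z * m t k + 1 / (4 * z))
    {R A B C x : ℝ} (hA : 0 < A) (hB : 0 ≤ B) (hx0 : 0 < x) (hx1 : x ≤ 1)
    (hup : R ≤ A * ∑ t : Fin T, 1 / √((t : ℝ) + 1) * ∑ k ∈ s, e t k + B)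
    (hlow : ∑ t, ∑ k ∈ s, Δ k * m t k - 2 * C ≤ R) :
    R ≤ A ^ 2 / x * ((1 + Real.log T) * ∑ k ∈ s, 1 / Δ k) + 2 * x * C + 2 * B := by
  have hterm : ∀ t : Fin T, ∀ k ∈ s, (1 + x) * (A * (1 / √((t : ℝ) + 1) * e t k)) -
      x * (Δ k * m t k) ≤ A ^ 2 / x * (1 / ((t : ℝ) + 1) * (1 / Δ k)) := by
    intro t k hk
    have ht : (0 : ℝ) ≤ t := Nat.cast_nonneg _
    have hd := hΔ k hk
    have hs : 0 < √((t : ℝ) + 1) := Real.sqrt_pos.2 (by linarith)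
    have hsq : (t : ℝ) + 1 = √((t : ℝ) + 1) ^ 2 := (Real.sq_sqrt (by linarith)).symm
    rw [hsq, Real.sqrt_sq hs.le]
    generalize √((t : ℝ) + 1) = σ at hs
    -- this weight makes the linear terms cancel
    have hz : 0 < x * Δ k * σ / ((1 + x) * A) := by positivity
    have h1 := mul_le_mul_of_nonneg_left (hem t k hk _ hz)
      (by positivity : 0 ≤ (1 + x) * A / σ)
    have h2 : (1 + x) * A / σ * (x * Δ k * σ / ((1 + x) * A) * m t k +
        1 / (4 * (x * Δ k * σ / ((1 + x) * A)))) =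
        x * (Δ k * m t k) + (1 + x) ^ 2 / 4 * (A ^ 2 / x * (1 / σ ^ 2 * (1 / Δ k))) := by
      field_simp
    have h3 : (1 + x) ^ 2 / 4 ≤ 1 := by nlinarith
    have h4 := mul_le_mul_of_nonneg_right h3
      (by positivity : 0 ≤ A ^ 2 / x * (1 / σ ^ 2 * (1 / Δ k)))
    have h5 : (1 + x) * (A * (1 / σ * e t k)) = (1 + x) * A / σ * e t k := by ring
    rw [h2] at h1
    rw [h5]
    linarith
  have hsum := Finset.sum_le_sum fun t (_ : t ∈ Finset.univ) =>
    Finset.sum_le_sum fun k hk => hterm t k hk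
  simp only [Finset.sum_sub_distrib, ← Finset.mul_sum, ← Finset.sum_mul] at hsum
  have hH : (∑ t : Fin T, 1 / ((t : ℝ) + 1)) * ∑ k ∈ s, 1 / Δ k ≤
      (1 + Real.log T) * ∑ k ∈ s, 1 / Δ k :=
    mul_le_mul_of_nonneg_right (sum_one_div_le T)
      (Finset.sum_nonneg fun k hk => (one_div_pos.2 (hΔ k hk)).le)
  have hH2 := mul_le_mul_of_nonneg_left hH (by positivity : 0 ≤ A ^ 2 / x)
  have h6 := mul_le_mul_of_nonneg_left hup (by linarith : 0 ≤ 1 + x)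
  have h7 := mul_le_mul_of_nonneg_left hlow hx0.le
  have h8 := mul_le_mul_of_nonneg_right hx1 hB
  linarith

/-- Optimization of the weight in the self-bounding argument. -/
lemma le_add_sqrt_of_forall_weight {R M C B : ℝ} (hM : 0 < M) (hC : 0 ≤ C)
    (h : ∀ x, 0 < x → x ≤ 1 → R ≤ M / x + 2 * x * C + 2 * B) :
    R ≤ M + 3 * √(C * M) + 2 * B := by
  rcases le_total C M with hCM | hCM
  · have h1 := h 1 one_pos le_rfl
    have h2 : C ≤ √(C * M) := Real.le_sqrt_of_sq_le (by nlinarith)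
    rw [div_one] at h1
    linarith
  · have hC0 : 0 < C := hM.trans_le hCM
    have hc0 : 0 < √C := Real.sqrt_pos.2 hC0
    have hm0 : 0 < √M := Real.sqrt_pos.2 hM
    have h1 := h (√M / √C) (by positivity) ((div_le_one hc0).2 (Real.sqrt_le_sqrt hCM))
    have h2 : M / (√M / √C) = √C * √M := by
      nth_rewrite 1 [← Real.mul_self_sqrt hM.le]
      field_simp
    have h3 : 2 * (√M / √C) * C = 2 * (√C * √M) := by
      nth_rewrite 2 [← Real.mul_self_sqrt hC0.le]
      field_simp
    rw [h2, h3] at h1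
    rw [Real.sqrt_mul hC]
    linarith

end Final

theorem mainTheorem1 {N K T : ℕ} (hT : 2 ≤ T) (hNT : 3 ^ 11 ≤ N * T)
    (G : SimpleGraph (Fin N)) (c : Fin N → Fin K) (hc : IsMinimumCliquePartition G c)
    {Ω : Type*} [MeasurableSpace Ω] (P : Measure Ω) [IsProbabilityMeasure P]
    (ν : Measure (Fin N → ℝ)) (lt l : Fin T → Ω → Fin N → ℝ) (I : Fin T → Ω → Fin N)
    (henv : IsCorruptedStochastic P ν lt l I)
    (istar : Fin N) (hstar : ∀ i, i ≠ istar → meanLoss ν istar < meanLoss ν i)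
    (p : Fin T → Ω → Fin N → ℝ)
    (hp : ∀ ω, IsFTRLPrediction G c (fun t => l t ω) (fun t => I t ω) (fun t => p t ω))
    (hI : IsSampledFrom P l I p) :
    pseudoRegret P l I ≤
        184 * Real.log ((N : ℝ) * T) ^ 2 *
          min (√((K : ℝ) * T))
            (Real.log ((N : ℝ) * T) ^ 2 * gapSum T ν c istar +
              √(corruptionLevel P lt l * gapSum T ν c istar)) ∧
      pseudoRegret P l I ≤ 184 * Real.log ((N : ℝ) * T) ^ 2 * √((K : ℝ) * T) ∧
      (corruptionLevel P lt l = 0 →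
        pseudoRegret P l I ≤ 184 * Real.log ((N : ℝ) * T) ^ 4 * gapSum T ν c istar) := by
  have hT1 : 1 ≤ T := by omega
  have hL12 : 12 ≤ Real.log ((N : ℝ) * T) := twelve_le_log_of_le (by exact_mod_cast hNT)
  obtain ⟨L, hL⟩ : ∃ L, L = Real.log ((N : ℝ) * T) := ⟨_, rfl⟩
  have hpS : ∀ t ω, p t ω ∈ truncatedSimplex N (1 / ((N : ℝ) * T)) := fun t ω =>
    ((isFTRLPrediction_iff hc.1).1 (hp ω) t).1
  have hpm : ∀ t, Measurable (p t) := fun t =>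
    (measurable_prediction hc.1 hT1 hL12 istar hp t).mono (henv.pastInteraction_le t) le_rfl
  have hNe : Nonempty (Fin N) := ⟨istar⟩
  obtain ⟨j, hj⟩ := exists_eq_ciInf_of_finite (f := fun i : Fin N => ∫ ω, ∑ t, l t ω i ∂P)
  have hR : pseudoRegret P l I = (∫ ω, ∑ t, l t ω (I t ω) ∂P) - ∫ ω, ∑ t, l t ω j ∂P := by
    rw [pseudoRegret, ← hj]
  have hup := regret_le_sum_residualMass hc.1 hT1 rfl hL12 henv hp hI istar j
  have hlow := sum_cliqueGap_mul_le_regret hc.1 hT1 hL12 henv hp hI istar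
  have hge : (∫ ω, ∑ t, l t ω (I t ω) ∂P) - ∫ ω, ∑ t, l t ω istar ∂P ≤ pseudoRegret P l I := by
    have := ciInf_le (Set.finite_range fun i : Fin N => ∫ ω, ∑ t, l t ω i ∂P).bddBelow istar
    rw [pseudoRegret]
    linarith
  rw [← hR] at hup
  have hlow := hlow.trans hge
  have hRT : pseudoRegret P l I ≤ T := by
    have h1 : ∫ ω, ∑ t, l t ω (I t ω) ∂P ≤ ∑ _t : Fin T, (1 : ℝ) := by
      have h2 := integral_mono (integrable_finsetSum Finset.univ fun t _ =>
        henv.integrable_loss_arm t) (integrable_const (∑ _t : Fin T, (1 : ℝ)))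
        (fun ω => Finset.sum_le_sum fun t _ => (henv.loss_mem t ω (I t ω)).2)
      rwa [integral_const, probReal_univ, one_smul] at h2
    have h3 : 0 ≤ ∫ ω, ∑ t, l t ω j ∂P :=
      integral_nonneg fun ω => Finset.sum_nonneg fun t _ => (henv.loss_mem t ω j).1
    rw [Finset.sum_const, Finset.card_univ, Fintype.card_fin, nsmul_eq_mul, mul_one] at h1
    rw [hR]
    linarith
  have hC0 : 0 ≤ corruptionLevel P lt l :=
    integral_nonneg fun ω => Finset.sum_nonneg fun t _ => norm_nonneg _
  have hG0 := gapSum_nonneg (c := c) hT1 ν istar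
  rw [← hL] at hL12 hup ⊢
  have hL2 : 144 ≤ L ^ 2 := by nlinarith
  have hL3 : 12 * L ≤ L ^ 2 := by nlinarith
  have hTr : (1 : ℝ) ≤ T := by exact_mod_cast hT1
  have hK1 : (1 : ℝ) ≤ K := by exact_mod_cast (c istar).pos
  -- the bound that holds for any corruption
  have hadv : pseudoRegret P l I ≤ 184 * L ^ 2 * √((K : ℝ) * T) := by
    rcases le_total (T : ℝ) K with hKT | hKT
    · -- the regret is at most `T`
      have h1 : (T : ℝ) ≤ √((K : ℝ) * T) := Real.le_sqrt_of_sq_le (by nlinarith)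
      nlinarith
    · have h1 : (K : ℝ) ≤ √((K : ℝ) * T) := Real.le_sqrt_of_sq_le (by nlinarith)
      have h2 : ∑ t : Fin T, 1 / √((t : ℝ) + 1) *
          ∫ ω, ∑ k, √(residualMass c istar (p t ω) k) ∂P ≤ 2 * √((K : ℝ) * T) := by
        have h3 : ∀ t : Fin T, 1 / √((t : ℝ) + 1) *
            ∫ ω, ∑ k, √(residualMass c istar (p t ω) k) ∂P ≤ 1 / √((t : ℝ) + 1) * √(K : ℝ) := by
          intro t
          refine mul_le_mul_of_nonneg_left ?_ (by positivity)
          have h4 := integral_mono (integrable_sum_sqrt_residualMass (P := P) (c := c) (hpm t)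
            (hpS t) istar) (integrable_const √(K : ℝ))
            fun ω => sum_sqrt_residualMass_le (hpS t ω) istar
          rwa [integral_const, probReal_univ, one_smul] at h4
        refine (Finset.sum_le_sum fun t _ => h3 t).trans ?_
        rw [← Finset.sum_mul, Real.sqrt_mul (by linarith)]
        have := mul_le_mul_of_nonneg_right (sum_one_div_sqrt_le T) (Real.sqrt_nonneg (K : ℝ))
        linarith
      have h5 := mul_le_mul_of_nonneg_left h2 (by positivity : 0 ≤ 3 * L ^ 2)
      have h6 : 9 * (K * L) + 2 * L ^ 2 + 3 ≤ 4 * L ^ 2 * K := by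
        have e1 := mul_le_mul_of_nonneg_left hL3 (by linarith : 0 ≤ (K : ℝ))
        have e2 := mul_le_mul_of_nonneg_left hK1 (by positivity : 0 ≤ L ^ 2)
        linarith
      have h7 := mul_le_mul_of_nonneg_left h1 (by positivity : 0 ≤ 4 * L ^ 2)
      have h8 : 0 ≤ L ^ 2 * √((K : ℝ) * T) := by positivity
      linarith
  -- the bound in terms of the gaps
  have hsto : pseudoRegret P l I ≤ 184 * L ^ 2 * (L ^ 2 * gapSum T ν c istar +
      √(corruptionLevel P lt l * gapSum T ν c istar)) := by
    by_cases hall : ∀ i, i = istar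
    · -- a single arm has no regret
      have h1 : pseudoRegret P l I = 0 := by
        rw [hR]
        simp only [hall j, fun t ω => hall (I t ω), sub_self]
      rw [h1]
      positivity
    push Not at hall
    obtain ⟨i, hi⟩ := hall
    have hμ : ∀ i, meanLoss ν i ∈ Set.Icc (0 : ℝ) 1 := fun i => by
      rw [← henv.integral_stoch ⟨0, hT1⟩ i]
      refine ⟨integral_nonneg fun ω => (henv.stoch_mem _ ω i).1, ?_⟩
      have h2 := integral_mono (henv.integrable_stoch ⟨0, hT1⟩ i) (integrable_const (1 : ℝ))
        fun ω => (henv.stoch_mem _ ω i).2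
      rwa [integral_const, probReal_univ, one_smul] at h2
    obtain ⟨hGK, hG1⟩ := le_gapSum hT hc.1.1 hstar hμ hi
    have hres : ∀ t k, Integrable (fun ω => residualMass c istar (p t ω) k) P := fun t k =>
      integrable_of_abs_le (B := 1) (measurable_residualMass (hpm t) istar k) fun ω => by
        rw [abs_of_nonneg (residualMass_nonneg (hpS t ω) istar k)]
        exact (residualMass_le (hpS t ω) istar k).trans (cliqueMass_le_one (hpS t ω) k)
    have hsqrt : ∀ t k, Integrable (fun ω => √(residualMass c istar (p t ω) k)) P := fun t k =>
      integrable_of_abs_le (B := 1) (measurable_residualMass (hpm t) istar k).sqrt fun ω => by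
        rw [abs_of_nonneg (Real.sqrt_nonneg _)]
        exact sqrt_residualMass_le_one (hpS t ω) istar k
    have hem : ∀ t k, ∀ z > 0, ∫ ω, √(residualMass c istar (p t ω) k) ∂P ≤
        z * (∫ ω, residualMass c istar (p t ω) k ∂P) + 1 / (4 * z) := by
      intro t k z hz
      have h1 := integral_mono (hsqrt t k) (((hres t k).const_mul z).add
        (integrable_const (1 / (4 * z)))) fun ω => by
          have h2 := Real.sq_sqrt (residualMass_nonneg (c := c) (hpS t ω) istar k)
          have h3 : 1 / (4 * z) * z = 1 / 4 := by field_simp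
          change _ ≤ z * residualMass c istar (p t ω) k + 1 / (4 * z)
          rw [← h2, Real.sqrt_sq (Real.sqrt_nonneg _)]
          generalize √(residualMass c istar (p t ω) k) = y
          have h4 : z * y ^ 2 + 1 / (4 * z) - y = (2 * z * y - 1) ^ 2 / (4 * z) := by
            field_simp
            ring
          have h5 : 0 ≤ (2 * z * y - 1) ^ 2 / (4 * z) := by positivity
          linarith
      simp only [Pi.add_apply] at h1
      rwa [integral_add ((hres t k).const_mul z) (integrable_const _), integral_const_mul,
        integral_const, probReal_univ, one_smul] at h1
    set s := Finset.univ.filter fun k => 0 < cliqueGap ν c istar k with hs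
    -- cliques without a gap contribute nothing
    have hsub : ∀ t, ∫ ω, ∑ k, √(residualMass c istar (p t ω) k) ∂P =
        ∑ k ∈ s, ∫ ω, √(residualMass c istar (p t ω) k) ∂P := fun t => by
      rw [integral_finsetSum _ fun k _ => hsqrt t k]
      refine (Finset.sum_subset (Finset.filter_subset _ _) fun k _ hk => ?_).symm
      have hk' : ¬0 < cliqueGap ν c istar k := fun h =>
        hk (Finset.mem_filter.2 ⟨Finset.mem_univ _, h⟩)
      simp [residualMass_eq_zero hstar hk']
    have hsub2 : ∀ t, ∑ k, cliqueGap ν c istar k * ∫ ω, residualMass c istar (p t ω) k ∂P =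
        ∑ k ∈ s, cliqueGap ν c istar k * ∫ ω, residualMass c istar (p t ω) k ∂P := fun t => by
      refine (Finset.sum_subset (Finset.filter_subset _ _) fun k _ hk => ?_).symm
      have hk' : ¬0 < cliqueGap ν c istar k := fun h =>
        hk (Finset.mem_filter.2 ⟨Finset.mem_univ _, h⟩)
      simp [residualMass_eq_zero hstar hk']
    simp only [hsub] at hup
    simp only [hsub2] at hlow
    have hΔ : ∀ k ∈ s, 0 < cliqueGap ν c istar k := fun k hk => (Finset.mem_filter.1 hk).2
    have hB : 0 ≤ 9 * (K * L) + 2 * L ^ 2 + 3 := by positivity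
    -- `1 + log T ≤ 2.45 log T`, because `T ≥ 2`
    have hlogT : (1 + Real.log T) * ∑ k ∈ s, 1 / cliqueGap ν c istar k ≤
        2.45 * gapSum T ν c istar := by
      have h1 : gapSum T ν c istar = Real.log T * ∑ k ∈ s, 1 / cliqueGap ν c istar k := by
        rw [gapSum, Finset.mul_sum]
        exact Finset.sum_congr rfl fun k _ => by rw [mul_one_div]
      have h2 : Real.log 2 ≤ Real.log T := Real.log_le_log (by norm_num) (by exact_mod_cast hT)
      have h3 := Real.log_two_gt_d9
      have h4 : 1 + Real.log T ≤ 2.45 * Real.log T := by norm_num at h3 ⊢; linarith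
      rw [h1, ← mul_assoc]
      exact mul_le_mul_of_nonneg_right h4
        (Finset.sum_nonneg fun k hk => (one_div_pos.2 (hΔ k hk)).le)
    have hfin := le_add_sqrt_of_forall_weight (R := pseudoRegret P l I)
      (M := (3 * L ^ 2) ^ 2 * (2.45 * gapSum T ν c istar)) (B := 9 * (K * L) + 2 * L ^ 2 + 3)
      (by have : 0 < gapSum T ν c istar := lt_of_lt_of_le (by norm_num) hG1
          positivity) hC0 fun x hx0 hx1 => by
        have h1 := self_bounding hΔ (fun t k _ => hem t k) (by positivity) hB hx0 hx1 hup hlow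
        have h2 := mul_le_mul_of_nonneg_left hlogT (by positivity : 0 ≤ (3 * L ^ 2) ^ 2 / x)
        rw [div_mul_eq_mul_div] at h2
        rw [div_mul_eq_mul_div] at h1 h2
        linarith
    generalize gapSum T ν c istar = S at *
    have h1 : √(corruptionLevel P lt l * ((3 * L ^ 2) ^ 2 * (2.45 * S))) ≤
        6 * L ^ 2 * √(corruptionLevel P lt l * S) := by
      refine Real.sqrt_le_iff.2 ⟨by positivity, ?_⟩
      rw [mul_pow (6 * L ^ 2), Real.sq_sqrt (mul_nonneg hC0 hG0)]
      have : 0 ≤ L ^ 4 * (corruptionLevel P lt l * S) := by positivity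
      linarith
    have h2 : 9 * (K * L) + 2 * L ^ 2 + 3 ≤ L ^ 4 * S := by
      norm_num at hGK hG1
      have e1 : (K : ℝ) * L ≤ 3 * S * L := mul_le_mul_of_nonneg_right (by linarith) (by linarith)
      have e2 : 12 * (S * L) ≤ L ^ 2 * S := by
        have := mul_le_mul_of_nonneg_right hL3 hG0
        linarith
      have e3 : L ^ 2 * 1 ≤ L ^ 2 * (2 * S) := mul_le_mul_of_nonneg_left (by linarith) (by linarith)
      have e4 : 144 * (L ^ 2 * S) ≤ L ^ 4 * S := by
        have := mul_le_mul_of_nonneg_right hL2 (by positivity : 0 ≤ L ^ 2 * S)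
        linarith
      linarith
    have h3 : 0 ≤ L ^ 4 * S := by positivity
    have h4 : 0 ≤ L ^ 2 * √(corruptionLevel P lt l * S) := by positivity
    linarith
  refine ⟨?_, hadv, fun hC => ?_⟩
  · rcases min_choice (√((K : ℝ) * T)) (L ^ 2 * gapSum T ν c istar +
      √(corruptionLevel P lt l * gapSum T ν c istar)) with h | h <;> rw [h]
    · exact hadv
    · exact hsto
  · rw [hC, zero_mul, Real.sqrt_zero, add_zero] at hsto
    linarith
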